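/- Let $n\ge 1$, let $a_1,\dots,a_n\in\mathbf Q^*\setminus\{\pm1\}$, and put $\Gamma=\langle a_1,\dots,a_n\rangle\subset\mathbf Q^*$ and $\Gamma_i=\langle a_i\rangle$. Let $\Gamma_\infty=\{x\in\mathbf C^*: x^m\in\Gamma\text{ for some }m\ge1\}$, let $A$ be the profinite group of all group automorphisms of $\Gamma_\infty$ that are the identity on $\Gamma_\infty\cap\mathbf Q^*$ (with the topology of pointwise convergence on the discrete set $\Gamma_\infty$), and let $\nu$ be its normalized Haar measure. View $G=\mathrm{Gal}(\mathbf Q(\Gamma_\infty)/\mathbf Q)$ as a subgroup of $A$ through its action on $\Gamma_\infty$. Let $S\subset A$ be the set of all $\alpha\in A$ such that for every prime $p$ and every $i\in\{1,\dots,n\}$ the automorphism $\alpha$ does not act trivially on $\Gamma_i^{1/p}=\{x\in\mathbf C^*:x^p\in\Gamma_i\}$. The density of $S\cap G$ is $\nu(G\cap S)/\nu(G)$. For a prime $p$, let $\overline\Gamma_p$ be the image of $\Gamma$ in $\mathbf Q^*/{\mathbf Q^*}^p$, and write $\mu_p\subset\mathbf C^*$ for the group of $p$-th roots of unity. Assume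 that there is no subset $I\subset\{1,\dots,n\}$ of odd cardinality for which $\prod_{i\in I}a_i$ is a square in $\mathbf Q^*$. Then there is a unique homomorphism $w_2:\overline\Gamma_2\to\mu_2$ with $w_2(a_i\bmod{\mathbf Q^*}^2)=-1$ for all $i$. **Theorem.** Under these assumptions, $S\cap G$ has density zero if and only if both of the following conditions hold: (a) $-3\bmod{\mathbf Q^*}^2$ lies in $\overline\Gamma_2$ and in the kernel of $w_2$; (b) for every homomorphism $\chi:\overline\Gamma_3\to\mu_3$ there is an $i$ with $\chi(a_i\bmod{\mathbf Q^*}^3)=1$. Moreover, if none of the $a_i$ is a cube in $\mathbf Q^*$, then condition (b) does not hold if $n\le3$, or if the $\mathbf F_3$-rank of $\overline\Gamma_3$ is either $1$ or at least $n-1$. -/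

import Mathlib

open MeasureTheory

noncomputable section

namespace RadicalDensity

/-- The inclusion `ℚ* → ℂ*`. -/
def ratUnits : ℚˣ →* ℂˣ := Units.map (algebraMap ℚ ℂ : ℚ →* ℂ)

/-- `Γ^{1/m} = {x ∈ ℂ* : x ^ m ∈ Γ}`. -/
def rootGroup (Γ : Subgroup ℚˣ) (m : ℕ) : Subgroup ℂˣ :=
  (Γ.map ratUnits).comap (powMonoidHom m)

/-- `Γ_∞ = {x ∈ ℂ* : x ^ m ∈ Γ for some m ≥ 1}`, the group of radicals of `Γ`. -/
def radicalGroup (Γ : Subgroup ℚˣ) : Subgroup ℂˣ where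
  carrier := {x | ∃ m : ℕ, 1 ≤ m ∧ x ^ m ∈ Γ.map ratUnits}
  one_mem' := ⟨1, le_rfl, by simp [one_mem]⟩
  mul_mem' := by
    rintro x y ⟨m, hm, hx⟩ ⟨k, hk, hy⟩
    refine ⟨m * k, Nat.mul_pos hm hk, ?_⟩
    rw [mul_pow, pow_mul x, mul_comm m k, pow_mul y]
    exact mul_mem (pow_mem hx k) (pow_mem hy m)
  inv_mem' := by
    rintro x ⟨m, hm, hx⟩
    refine ⟨m, hm, ?_⟩
    rw [inv_pow]
    exact inv_mem hx

/-- The group `A` of all group automorphisms of `Γ_∞` that are the identity on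
`Γ_0 = Γ_∞ ∩ ℚ*`. -/
def radAut (Γ : Subgroup ℚˣ) : Subgroup (MulAut (radicalGroup Γ)) where
  carrier := {α | ∀ x : radicalGroup Γ, (x : ℂˣ) ∈ ratUnits.range → α x = x}
  one_mem' := fun _ _ => rfl
  mul_mem' := by
    intro α β hα hβ x hx
    rw [MulAut.mul_apply, hβ x hx, hα x hx]
  inv_mem' := by
    intro α hα x hx
    rw [MulAut.inv_apply, MulEquiv.symm_apply_eq, hα x hx]

/-- The action of an element of `A` on `Γ_∞`. -/
def act {Γ : Subgroup ℚˣ} (α : radAut Γ) (x : radicalGroup Γ) : radicalGroup Γ := α.1 x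

/-- The (profinite) topology of pointwise convergence on `A`, with `Γ_∞` discrete. -/
instance radAutTopology (Γ : Subgroup ℚˣ) : TopologicalSpace (radAut Γ) :=
  TopologicalSpace.induced (act (Γ := Γ))
    (@Pi.topologicalSpace (radicalGroup Γ) (fun _ => radicalGroup Γ) (fun _ => ⊥))

theorem isOpen_act_eq {Γ : Subgroup ℚˣ} (x y : radicalGroup Γ) :
    IsOpen {α : radAut Γ | act α x = y} := by
  let : TopologicalSpace (radicalGroup Γ) := ⊥
  have h : @IsOpen (radicalGroup Γ) ⊥ {y} := trivial
  exact ⟨_, h.preimage (continuous_apply x), rfl⟩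

theorem continuous_into {Γ : Subgroup ℚˣ} {X : Type} [TopologicalSpace X] (f : X → radAut Γ)
    (h : ∀ x y, IsOpen {t | act (f t) x = y}) : Continuous f := by
  let : TopologicalSpace (radicalGroup Γ) := ⊥
  rw [continuous_induced_rng]
  refine continuous_pi fun x => ?_
  refine ⟨fun s _ => ?_⟩
  have : ((fun t => (act ∘ f) t x) ⁻¹' s) = ⋃ y ∈ s, {t | act (f t) x = y} := by
    ext t; simp
  rw [this]
  exact isOpen_biUnion fun y _ => h x y

instance radAutIsTopologicalGroup (Γ : Subgroup ℚˣ) : IsTopologicalGroup (radAut Γ) where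
  continuous_mul := by
    refine continuous_into _ fun x y => ?_
    have : {t : radAut Γ × radAut Γ | act (t.1 * t.2) x = y} =
        ⋃ z, {α | act α z = y} ×ˢ {β | act β x = z} := by
      ext t
      simp [act]
    rw [this]
    exact isOpen_iUnion fun z => (isOpen_act_eq z y).prod (isOpen_act_eq x z)
  continuous_inv := by
    refine continuous_into _ fun x y => ?_
    have : {t : radAut Γ | act t⁻¹ x = y} = {t | act t y = x} := by
      ext t
      simp only [act, Set.mem_ofPred_eq, InvMemClass.coe_inv, MulAut.inv_apply,
        MulEquiv.symm_apply_eq]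
      exact eq_comm
    rw [this]
    exact isOpen_act_eq y x

theorem finite_roots {Γ : Subgroup ℚˣ} (x : radicalGroup Γ) {m : ℕ} (hm : 1 ≤ m) :
    {y : radicalGroup Γ | y ^ m = x ^ m}.Finite := by
  have hf : ((Polynomial.nthRoots m (((x : ℂˣ) : ℂ) ^ m)).toFinset : Set ℂ).Finite :=
    Finset.finite_toSet _
  refine Set.Finite.of_finite_image (f := fun y : radicalGroup Γ => ((y : ℂˣ) : ℂ))
    (hf.subset ?_) ?_
  · rintro _ ⟨y, hy, rfl⟩
    have hy' := congrArg (fun z : radicalGroup Γ => ((z : ℂˣ) : ℂ)) hy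
    simpa [Polynomial.mem_nthRoots hm] using hy'
  · intro y _ z _ h
    exact Subtype.ext (Units.ext h)

instance radAutCompactSpace (Γ : Subgroup ℚˣ) : CompactSpace (radAut Γ) := by
  let : TopologicalSpace (radicalGroup Γ) := ⊥
  have : DiscreteTopology (radicalGroup Γ) := ⟨rfl⟩
  have hex : ∀ x : radicalGroup Γ, ∃ m : ℕ, 1 ≤ m ∧ (x : ℂˣ) ^ m ∈ ratUnits.range := by
    rintro ⟨x, m, hm, hx⟩
    exact ⟨m, hm, Subgroup.map_le_range _ _ hx⟩
  choose m hm hr using hex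
  let F : radicalGroup Γ → Set (radicalGroup Γ) := fun x => {y | y ^ m x = x ^ m x}
  have hcomp : IsCompact (Set.univ.pi F) :=
    isCompact_univ_pi fun x => (finite_roots x (hm x)).isCompact
  let C : Set (radicalGroup Γ → radicalGroup Γ) :=
    {f | (∀ x y, f (x * y) = f x * f y) ∧
      (∀ x : radicalGroup Γ, (x : ℂˣ) ∈ ratUnits.range → f x = x) ∧ ∀ x, f x = 1 → x = 1}
  have hev : ∀ (s : Set (radicalGroup Γ)) (x : radicalGroup Γ),
      IsClosed {f : radicalGroup Γ → radicalGroup Γ | f x ∈ s} := fun s x =>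
    (isClosed_discrete s).preimage (continuous_apply x)
  have hC : IsClosed C := by
    have : C = (⋂ x, ⋂ y, {f | f (x * y) = f x * f y}) ∩
        ((⋂ x : radicalGroup Γ, ⋂ _ : (x : ℂˣ) ∈ ratUnits.range, {f | f x ∈ ({x} : Set _)}) ∩
          ⋂ x, {f | f x ∈ {z | z = 1 → x = 1}}) := by
      ext f
      simp [C]
    rw [this]
    refine IsClosed.inter (isClosed_iInter fun x => isClosed_iInter fun y => ?_)
      (IsClosed.inter (isClosed_iInter fun x => isClosed_iInter fun _ => hev _ _)
        (isClosed_iInter fun x => hev _ _))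
    have hc : Continuous fun f : radicalGroup Γ → radicalGroup Γ => (f (x * y), (f x, f y)) :=
      (continuous_apply _).prodMk ((continuous_apply _).prodMk (continuous_apply _))
    exact (isClosed_discrete
      {t : radicalGroup Γ × (radicalGroup Γ × radicalGroup Γ) | t.1 = t.2.1 * t.2.2}).preimage hc
  have hrange : Set.range (act (Γ := Γ)) = Set.univ.pi F ∩ C := by
    ext f
    constructor
    · rintro ⟨α, rfl⟩
      refine ⟨fun x _ => ?_, fun x y => map_mul α.1 x y, α.2, fun x hx => ?_⟩
      · change (α.1 x) ^ m x = x ^ m x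
        rw [← map_pow]
        exact α.2 _ (by simpa using hr x)
      · exact (map_eq_one_iff α.1 α.1.injective).1 hx
    · rintro ⟨-, hmul, hfix, hinj⟩
      let g : radicalGroup Γ →* radicalGroup Γ := MonoidHom.mk' f hmul
      have gi : Function.Injective g := (injective_iff_map_eq_one g).2 hinj
      have gs : Function.Surjective g := by
        intro x
        have hmaps : Set.MapsTo g (F x) (F x) := by
          intro y hy
          change (g y) ^ m x = x ^ m x
          rw [← map_pow, show y ^ m x = x ^ m x from hy]
          exact hfix _ (by simpa using hr x)
        have hsurj := (((finite_roots x (hm x)).injOn_iff_bijOn_of_mapsTo hmaps).1 gi.injOn).surjOn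
        have hx : x ∈ F x := rfl
        obtain ⟨y, -, hy⟩ := hsurj hx
        exact ⟨y, hy⟩
      exact ⟨⟨MulEquiv.ofBijective g ⟨gi, gs⟩, hfix⟩, rfl⟩
  refine ⟨?_⟩
  rw [Topology.IsInducing.isCompact_iff (f := act (Γ := Γ)) ⟨rfl⟩, Set.image_univ, hrange]
  exact hcomp.inter_right hC

instance radAutMeasurableSpace (Γ : Subgroup ℚˣ) : MeasurableSpace (radAut Γ) :=
  borel (radAut Γ)

instance radAutBorelSpace (Γ : Subgroup ℚˣ) : BorelSpace (radAut Γ) := ⟨rfl⟩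

/-- The Haar measure `ν` on the compact group `A`, normalized by `ν(A) = 1`. -/
def haarA (Γ : Subgroup ℚˣ) : Measure (radAut Γ) := Measure.haarMeasure ⊤

/-- The field `ℚ(Γ_∞) ⊂ ℂ`. -/
def radicalField (Γ : Subgroup ℚˣ) : IntermediateField ℚ ℂ :=
  IntermediateField.adjoin ℚ ((fun x : ℂˣ => (x : ℂ)) '' (radicalGroup Γ : Set ℂˣ))

/-- An element of `Γ_∞`, viewed as an element of `ℚ(Γ_∞)`. -/
def toField {Γ : Subgroup ℚˣ} (x : radicalGroup Γ) : radicalField Γ :=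
  ⟨((x : ℂˣ) : ℂ), IntermediateField.subset_adjoin ℚ _ ⟨x, x.2, rfl⟩⟩

/-- The Galois group `G = Gal(ℚ(Γ_∞)/ℚ)` as a subset of `A`: those automorphisms of the group
`Γ_∞` that are the restriction of a field automorphism of `ℚ(Γ_∞)`. -/
def galoisImage (Γ : Subgroup ℚˣ) : Set (radAut Γ) :=
  {α | ∃ σ : radicalField Γ ≃ₐ[ℚ] radicalField Γ,
    ∀ x : radicalGroup Γ, σ (toField x) = toField (act α x)}

/-- The density `ν(G ∩ S) / ν(G)` of a subset `S` of `A` inside `G`. -/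
def densityInGalois (Γ : Subgroup ℚˣ) (S : Set (radAut Γ)) : ENNReal :=
  haarA Γ (galoisImage Γ ∩ S) / haarA Γ (galoisImage Γ)

section Generators

variable {n : ℕ} (a : Fin n → ℚˣ)

/-- `Γ = ⟨a_1, …, a_n⟩`. -/
def genGroup : Subgroup ℚˣ := Subgroup.closure (Set.range a)

/-- The inverse image in `A` of the kernel of the restriction map
`φ_{p,i} : A_p → Aut(Γ_i^{1/p})`, where `Γ_i = ⟨a_i⟩`:
the elements of `A` that act trivially on `Γ_i^{1/p} ⊂ Γ_∞`. -/
def kerRestrict (p : ℕ) (i : Fin n) : Set (radAut (genGroup a)) :=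
  {α | ∀ x : radicalGroup (genGroup a),
    (x : ℂˣ) ∈ rootGroup (Subgroup.zpowers (a i)) p → act α x = x}

/-- The inverse image in `A` of `S_p = A_p \ ⋃_i ker φ_{p,i}`. -/
def localGood (p : ℕ) : Set (radAut (genGroup a)) := (⋃ i, kerRestrict a p i)ᶜ

/-- The set `S = ∏_p S_p`; under `A = ∏_p A_p` a product of subsets of the `A_p` is the
intersection of their inverse images in `A`. -/
def goodSet : Set (radAut (genGroup a)) := ⋂ p : Nat.Primes, localGood a p

/-- No product of an odd number of the `a_i` (with distinct indices) is a square in `ℚ*`. -/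
def NoOddSquare : Prop :=
  ∀ I : Finset (Fin n), Odd I.card → ¬ IsSquare (∏ i ∈ I, a i)

end Generators

/-- The class map `ℚ* → ℚ*/ℚ*^p`. -/
def classMap (p : ℕ) : ℚˣ →* ℚˣ ⧸ (powMonoidHom p : ℚˣ →* ℚˣ).range :=
  QuotientGroup.mk' _

/-- `Γ̄_p = im[Γ → ℚ*/ℚ*^p]`. -/
def barGroup (Γ : Subgroup ℚˣ) (p : ℕ) :
    Subgroup (ℚˣ ⧸ (powMonoidHom p : ℚˣ →* ℚˣ).range) :=
  Γ.map (classMap p)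

theorem barGroup_pow (Γ : Subgroup ℚˣ) (p : ℕ) (x : barGroup Γ p) : x ^ p = 1 := by
  obtain ⟨_, y, -, rfl⟩ := x
  refine Subtype.ext ?_
  change classMap p y ^ p = 1
  rw [← map_pow]
  exact (QuotientGroup.eq_one_iff _).2 ⟨y, rfl⟩

/-- The `𝔽_p`-rank of the elementary abelian `p`-group `Γ̄_p`. -/
def barRank (Γ : Subgroup ℚˣ) (p : ℕ) : ℕ :=
  letI : Module (ZMod p) (Additive (barGroup Γ p)) :=
    AddCommGroup.zmodModule fun x => barGroup_pow Γ p x.toMul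
  Module.finrank (ZMod p) (Additive (barGroup Γ p))

section Generators

variable {n : ℕ} (a : Fin n → ℚˣ)

/-- The class of `a_i` in `Γ̄_p`. -/
def genClass (p : ℕ) (i : Fin n) : barGroup (genGroup a) p :=
  ⟨classMap p (a i), a i, Subgroup.subset_closure ⟨i, rfl⟩, rfl⟩

/-- The homomorphism `ℤ^n → Γ̄_p` given by the generators. -/
def expMap (p : ℕ) : Multiplicative (Fin n → ℤ) →* barGroup (genGroup a) p where
  toFun e := ∏ i, genClass a p i ^ (e.toAdd i)
  map_one' := by simp
  map_mul' e f := by simp [zpow_add, Finset.prod_mul_distrib]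

theorem expMap_single (p : ℕ) (i : Fin n) :
    expMap a p (Multiplicative.ofAdd (Pi.single i 1)) = genClass a p i := by
  change ∏ j, genClass a p j ^ ((Pi.single i 1 : Fin n → ℤ) j) = _
  rw [Finset.prod_eq_single i]
  · simp
  · intro j _ hj
    simp [Pi.single_eq_of_ne hj]
  · simp

theorem expMap_surjective (p : ℕ) : Function.Surjective (expMap a p) := by
  rintro ⟨_, y, hy, rfl⟩
  induction hy using Subgroup.closure_induction with
  | mem x hx =>
    obtain ⟨i, rfl⟩ := hx
    exact ⟨_, expMap_single a p i⟩
  | one => exact ⟨1, by rw [map_one]; exact Subtype.ext (map_one _).symm⟩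
  | mul x y _ _ hx hy =>
    obtain ⟨e, he⟩ := hx
    obtain ⟨f, hf⟩ := hy
    exact ⟨e * f, by rw [map_mul, he, hf]; exact Subtype.ext (map_mul _ _ _).symm⟩
  | inv x _ hx =>
    obtain ⟨e, he⟩ := hx
    exact ⟨e⁻¹, by rw [map_inv, he]; exact Subtype.ext (map_inv _ _).symm⟩

/-- If no odd product of the `a_i` is a square, there is a unique homomorphism
`Γ̄_2 → μ_2 = {±1}` that sends the class of every `a_i` to `-1`. -/
theorem existsUnique_w2 (h : NoOddSquare a) :
    ∃! w : barGroup (genGroup a) 2 →* ℤˣ, ∀ i, w (genClass a 2 i) = -1 := by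
  let s : Multiplicative (Fin n → ℤ) →* ℤˣ :=
    { toFun := fun e => ∏ i, (-1 : ℤˣ) ^ (e.toAdd i)
      map_one' := by simp
      map_mul' := fun e f => by simp [zpow_add, Finset.prod_mul_distrib] }
  have hs : ∀ i, s (Multiplicative.ofAdd (Pi.single i 1)) = -1 := by
    intro i
    change ∏ j, (-1 : ℤˣ) ^ ((Pi.single i 1 : Fin n → ℤ) j) = _
    rw [Finset.prod_eq_single i]
    · simp
    · intro j _ hj
      simp [Pi.single_eq_of_ne hj]
    · simp
  have hker : (expMap a 2).ker ≤ s.ker := by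
    intro e he
    let I : Finset (Fin n) := Finset.univ.filter fun i => Odd (e.toAdd i)
    have key : ∀ {M : Type} [CommGroup M] (g : Fin n → M), (∀ i, g i ^ 2 = 1) →
        ∏ i, g i ^ (e.toAdd i) = ∏ i ∈ I, g i := by
      intro M _ g hg
      rw [Finset.prod_filter]
      refine Finset.prod_congr rfl fun i _ => ?_
      have hg' : g i * g i = 1 := by rw [← sq, hg]
      split_ifs with ho
      · obtain ⟨k, hk⟩ := ho
        rw [hk, zpow_add, zpow_mul, zpow_one, zpow_ofNat, hg, one_zpow, one_mul]
      · obtain ⟨k, hk⟩ := Int.not_odd_iff_even.1 ho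
        rw [hk, zpow_add, ← mul_zpow, hg', one_zpow]
    have h1 : ∏ i ∈ I, genClass a 2 i = 1 := by
      rw [← key _ fun i => barGroup_pow _ _ _]
      exact he
    have h2 : classMap 2 (∏ i ∈ I, a i) = 1 := by
      have := congrArg (barGroup (genGroup a) 2).subtype h1
      rw [map_prod, map_one] at this
      rw [map_prod]
      exact this
    have h3 : IsSquare (∏ i ∈ I, a i) := by
      obtain ⟨y, hy⟩ := (QuotientGroup.eq_one_iff _).1 h2
      exact ⟨y, by rw [← sq]; exact hy.symm⟩
    have h4 : Even I.card := by
      rw [← Nat.not_odd_iff_even]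
      exact fun ho => h I ho h3
    change ∏ i, (-1 : ℤˣ) ^ (e.toAdd i) = 1
    rw [key (fun _ => (-1 : ℤˣ)) fun _ => by simp, Finset.prod_const, h4.neg_one_pow]
  refine ⟨(expMap a 2).liftOfSurjective (expMap_surjective a 2) ⟨s, hker⟩, fun i => ?_, ?_⟩
  · have := (expMap a 2).liftOfRightInverse_comp_apply _
      (Function.rightInverse_surjInv (expMap_surjective a 2)) ⟨s, hker⟩
      (Multiplicative.ofAdd (Pi.single i 1))
    rw [expMap_single, hs] at this
    exact this
  · intro w hw
    have hcomp : ∀ e, w (expMap a 2 e) = s e := by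
      intro e
      change w (∏ i, genClass a 2 i ^ (e.toAdd i)) = ∏ i, (-1 : ℤˣ) ^ (e.toAdd i)
      rw [map_prod]
      exact Finset.prod_congr rfl fun i _ => by rw [map_zpow, hw]
    refine MonoidHom.ext fun x => ?_
    obtain ⟨e, rfl⟩ := expMap_surjective a 2 x
    rw [hcomp]
    exact ((expMap a 2).liftOfRightInverse_comp_apply _
      (Function.rightInverse_surjInv (expMap_surjective a 2)) ⟨s, hker⟩ e).symm

/-- The homomorphism `w_2 : Γ̄_2 → μ_2 = {±1}` with `w_2(a_i) = -1` for all `i`. -/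
def w2 (h : NoOddSquare a) : barGroup (genGroup a) 2 →* ℤˣ :=
  (existsUnique_w2 a h).choose

/-- The kernel of `w_2`, a subgroup of `Γ̄_2 ⊂ ℚ*/ℚ*^2`, contains the class of `-3`
(in particular this class lies in `Γ̄_2`). -/
def CondA (h : NoOddSquare a) : Prop :=
  classMap 2 (Units.mk0 (-3) (by norm_num)) ∈
    (w2 a h).ker.map (barGroup (genGroup a) 2).subtype

/-- The kernel of every character `Γ̄_3 → μ_3` contains the class of some `a_i`. -/
def CondB : Prop :=
  ∀ χ : barGroup (genGroup a) 3 →* rootsOfUnity 3 ℂ, ∃ i, genClass a 3 i ∈ χ.ker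

end Generators

end RadicalDensity

end

/-!
Let `L = ℚ(Γ_∞)`. The argument rests on a description of `Gal(L/ℚ)` inside `A` that is precise enough
to construct Galois automorphisms with prescribed actions on radicals.

*Kummer theory.* Let `Ω/F` be Galois and let the Galois group act on the elements of a group `B`
of nonzero elements of `Ω` through multiplication by elements of `F`. By Dedekind's theorem,
representatives of `B` modulo `F*` are linearly independent over `F`; hence every homomorphism on
`B` that is the identity on `B ∩ F` extends to a Galois automorphism
(`exists_algEquiv_of_monoidHom`). It is used over `F = ℚ` for square roots
(`exists_galois_neg_sqrt`), and over `F = ℚ(μ_∞)`. The elements of `Γ_∞` in `ℚ(μ_∞)` are of the form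
`ζ √q` with `ζ` a root of unity and `q` rational (`eq_rootOfUnity_mul_sqrt`), so that over `ℚ(μ_∞)`
the only entanglement between radicals comes from square roots of rational numbers.

*Conditions (a) and (b) imply `G ∩ S = ∅`.* A Galois automorphism satisfying the local condition at
`2` changes the sign of every `√a_i`. It acts on the square roots of elements of `Γ` through `w_2`,
so by (a) it fixes `√-3` and the cube roots of unity. It then acts on the cube roots of `Γ` through
a character of `Γ̄_3`, and by (b) it fixes a cube root of some `a_i`, contradicting the local
condition at `3` (`galoisImage_inter_goodSet_eq_empty`).

*If (a) or (b) fails, `G ∩ S` has positive measure.* If (a) fails, no odd product of the numbers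
`-3, a_1, …, a_n` is a square, so some Galois automorphism changes the sign of all `√a_i` and of
`√-3`. If (b) fails, one prescribes the signs of the `√a_i` and, when the cube roots of unity
are fixed, the action on the cube roots of `Γ`. In both cases multiplication by squares
of Galois automorphisms yields nontrivial actions on the `p`-th roots of unity for `5 ≤ p ≤ P`
(`exists_galois_locally_good`). All elements of a coset of a subgroup `H` of `G` fixing finitely
many radicals then satisfy the local conditions at `p ≤ P`. Such an `H` has positive measure,
since it has countably many cosets in `A` (`haarA_galoisFixing_pos`): the group `Gal(ℚ(μ_∞)/ℚ)` is the
full automorphism group of the roots of unity, and the square roots of rationals in `Γ_∞`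
fall into finitely many classes modulo `ℚ*`. For `p > P` the automorphisms in the coset that are
trivial on `Γ_i^{1/p}` have relative measure at most `12 / p ^ 2`, because `H` induces at
least `p (p - 1) / 6` automorphisms of `Γ_i^{1/p}` (`haarA_coset_inter_kerRestrict_le`). For large `P`
these proportions add up to less than `1` (`haarA_galois_inter_goodSet_pos`).

*Failure of (b).* This is linear algebra over `𝔽_3`: the classes of the `a_i` are `n` nonzero vectors
spanning `Γ̄_3`, and a linear form without zeros among them is sought
(`exists_linearForm_ne_zero`, `not_condB`).
-/

open MeasureTheory

noncomputable section

namespace RadicalDensity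

/-! ### Kummer characters -/

section Kummer

variable {F Ω : Type*} [Field F] [Field Ω] [Algebra F Ω] [IsGalois F Ω]

theorem mem_range_algebraMap_of_fixed {x : Ω} (h : ∀ τ : Ω ≃ₐ[F] Ω, τ x = x) :
    x ∈ Set.range (algebraMap F Ω) :=
  (InfiniteGalois.mem_range_algebraMap_iff_fixed x).2 h

/-- Elements on which the Galois group acts through multiplication by constants are linearly
independent as soon as they lie in different classes modulo the base field: the factors by which
the Galois group acts on them are distinct characters, and Dedekind's theorem applies. -/
theorem linearIndependent_of_galois_characters {ι : Type*} (r : ι → Ω) (hr0 : ∀ i, r i ≠ 0)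
    (hr : ∀ (τ : Ω ≃ₐ[F] Ω) i, τ (r i) / r i ∈ Set.range (algebraMap F Ω))
    (hne : ∀ i j, r i / r j ∈ Set.range (algebraMap F Ω) → i = j) :
    LinearIndependent F r := by
  let χ : ι → ((Ω ≃ₐ[F] Ω) →* Ω) := fun i =>
    { toFun := fun τ => τ (r i) / r i
      map_one' := by simp [hr0 i]
      map_mul' := by
        intro τ₁ τ₂
        obtain ⟨c, hc⟩ := hr τ₂ i
        have h2 : τ₂ (r i) = algebraMap F Ω c * r i := by
          rw [hc, div_mul_cancel₀ _ (hr0 i)]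
        have h1 := hr0 i
        rw [AlgEquiv.mul_apply, h2, map_mul, AlgEquiv.commutes]
        field_simp }
  have hχ : Function.Injective χ := by
    intro i j hij
    apply hne
    apply mem_range_algebraMap_of_fixed
    intro τ
    have h : τ (r i) / r i = τ (r j) / r j := DFunLike.congr_fun hij τ
    have hi := hr0 i
    have hj := hr0 j
    have hj' : τ (r j) ≠ 0 := by simpa using hj
    rw [map_div₀, div_eq_div_iff hj' hj]
    rw [div_eq_div_iff hi hj] at h
    linear_combination h
  have hlin := (linearIndependent_monoidHom (Ω ≃ₐ[F] Ω) Ω).comp χ hχ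
  rw [linearIndependent_iff'] at hlin ⊢
  intro s c hc i hi
  have := hlin s (fun i => algebraMap F Ω (c i) * r i) (by
    funext τ
    rw [Finset.sum_apply, Pi.zero_apply, ← map_zero τ, ← hc, map_sum]
    refine Finset.sum_congr rfl fun j _ => ?_
    have hj := hr0 j
    change algebraMap F Ω (c j) * r j * (τ (r j) / r j) = _
    rw [Algebra.smul_def, map_mul, AlgEquiv.commutes]
    field_simp) i hi
  have h0 := (mul_eq_zero.1 this).resolve_right (hr0 i)
  simpa using h0

/-- An algebra homomorphism that kills every relation of a family of elements of a normal
extension is induced by a Galois automorphism. -/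
theorem exists_algEquiv_of_ker_le {R : Type*} [CommRing R] [Algebra F R] (π Φ : R →ₐ[F] Ω)
    (h : ∀ x, π x = 0 → Φ x = 0) : ∃ τ : Ω ≃ₐ[F] Ω, ∀ x, τ (π x) = Φ x := by
  let E : IntermediateField F Ω := π.range.toIntermediateField fun x hx =>
    Subalgebra.inv_mem_of_algebraic π.range (x := ⟨x, hx⟩) (Algebra.IsAlgebraic.isAlgebraic x)
  let π' : R →ₐ[F] E := π.codRestrict E.toSubalgebra fun x => ⟨x, rfl⟩
  have hsurj : Function.Surjective π' := by
    rintro ⟨_, x, rfl⟩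
    exact ⟨x, rfl⟩
  have hker : ∀ x ∈ RingHom.ker π', Φ x = 0 := by
    intro x hx
    exact h x (congrArg Subtype.val hx)
  let g : E →ₐ[F] Ω := (Ideal.Quotient.liftₐ (RingHom.ker π') Φ hker).comp
    (Ideal.quotientKerAlgEquivOfSurjective hsurj).symm.toAlgHom
  have hg : ∀ x, g (π' x) = Φ x := by
    intro x
    have : (Ideal.quotientKerAlgEquivOfSurjective hsurj).symm (π' x) =
        Ideal.Quotient.mk (RingHom.ker π') x := by
      rw [AlgEquiv.symm_apply_eq]
      rfl
    change (Ideal.Quotient.liftₐ (RingHom.ker π') Φ hker)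
      ((Ideal.quotientKerAlgEquivOfSurjective hsurj).symm (π' x)) = _
    rw [this]
    rfl
  refine ⟨AlgEquiv.ofBijective (g.liftNormal Ω) (AlgHom.normal_bijective F Ω Ω _), fun x => ?_⟩
  have := g.liftNormal_commutes Ω (π' x)
  rw [hg] at this
  exact this

/-- Extension of Kummer characters: let the Galois group of `Ω/F` act on the elements `ι b` of a
group `B` through multiplication by constants. Then any homomorphism `β` on `B` that agrees with `ι`
on the elements of `B` in the base field is the restriction of a Galois automorphism. -/
theorem exists_algEquiv_of_monoidHom {B : Type*} [CommGroup B] (ι β : B →* Ω)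
    (hι : ∀ (τ : Ω ≃ₐ[F] Ω) b, τ (ι b) / ι b ∈ Set.range (algebraMap F Ω))
    (hβ : ∀ b, ι b ∈ Set.range (algebraMap F Ω) → β b = ι b) :
    ∃ τ : Ω ≃ₐ[F] Ω, ∀ b, τ (ι b) = β b := by
  have hne : ∀ b, ι b ≠ 0 := fun b => ((Group.isUnit b).map ι).ne_zero
  let N : Subgroup B :=
    { carrier := {b | ι b ∈ Set.range (algebraMap F Ω)}
      one_mem' := ⟨1, by simp⟩
      mul_mem' := by
        rintro x y ⟨c, hc⟩ ⟨d, hd⟩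
        exact ⟨c * d, by simp [hc, hd]⟩
      inv_mem' := by
        rintro x ⟨c, hc⟩
        exact ⟨c⁻¹, by
          rw [map_inv₀, hc]
          exact (eq_inv_of_mul_eq_one_left (by rw [← map_mul, inv_mul_cancel, map_one])).symm⟩ }
  let r : B ⧸ N → B := Quotient.out
  have hk : ∀ b : B, ∃ k : F, ι b = k • ι (r b) ∧ β b = k • β (r b) := by
    intro b
    have hN : (r b)⁻¹ * b ∈ N := QuotientGroup.eq.1 (QuotientGroup.out_eq' (b : B ⧸ N))
    obtain ⟨k, hk⟩ := hN
    have hb : b = r b * ((r b)⁻¹ * b) := by group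
    refine ⟨k, ?_, ?_⟩
    · rw [Algebra.smul_def, hk, ← map_mul, mul_comm, ← hb]
    · rw [Algebra.smul_def, hk, ← hβ _ ⟨k, hk⟩, ← map_mul, mul_comm, ← hb]
  have hlin : LinearIndependent F fun q : B ⧸ N => ι (r q) := by
    refine linearIndependent_of_galois_characters _ (fun q => hne _) (fun τ q => hι τ _) ?_
    rintro i j ⟨c, hc⟩
    have hmem : (r j)⁻¹ * r i ∈ N := by
      refine ⟨c, ?_⟩
      rw [hc, div_eq_iff (hne _), ← map_mul]
      congr 1
      rw [mul_comm, mul_inv_cancel_left]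
    have := QuotientGroup.eq.2 hmem
    rw [QuotientGroup.out_eq', QuotientGroup.out_eq'] at this
    exact this.symm
  let π := MonoidAlgebra.lift F Ω B ι
  let Φ := MonoidAlgebra.lift F Ω B β
  have hrep : ∀ x, ∃ y : (B ⧸ N) →₀ F,
      π x = Finsupp.linearCombination F (fun q => ι (r q)) y ∧
      Φ x = Finsupp.linearCombination F (fun q => β (r q)) y := by
    intro x
    induction x using MonoidAlgebra.induction_linear with
    | zero => exact ⟨0, by simp⟩
    | add x x' hx hx' =>
      obtain ⟨y, h1, h2⟩ := hx
      obtain ⟨y', h1', h2'⟩ := hx'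
      exact ⟨y + y', by rw [map_add, map_add, h1, h1'], by rw [map_add, map_add, h2, h2']⟩
    | single b c =>
      obtain ⟨k, h1, h2⟩ := hk b
      refine ⟨Finsupp.single (b : B ⧸ N) (c * k), ?_, ?_⟩
      · simp only [π, MonoidAlgebra.lift_single, Finsupp.linearCombination_single, mul_smul]
        rw [h1]
      · simp only [Φ, MonoidAlgebra.lift_single, Finsupp.linearCombination_single, mul_smul]
        rw [h2]
  obtain ⟨τ, hτ⟩ := exists_algEquiv_of_ker_le π Φ (by
    intro x hx
    obtain ⟨y, h1, h2⟩ := hrep x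
    rw [hx] at h1
    have hy : y = 0 := hlin (by rw [map_zero]; exact h1.symm)
    rw [h2, hy, map_zero])
  refine ⟨τ, fun b => ?_⟩
  have := hτ (MonoidAlgebra.of F B b)
  simpa [π, Φ] using this

end Kummer

/-! ### The Galois group of the field of radicals as a closed subgroup of `A` -/

section GaloisAction

variable {Γ : Subgroup ℚˣ}

theorem toField_injective : Function.Injective (toField (Γ := Γ)) := fun _ _ h =>
  Subtype.ext (Units.ext (congrArg Subtype.val h))

/-- The inclusion of `Γ_∞` in `ℚ(Γ_∞)` as a homomorphism of monoids. -/
def toFieldHom (Γ : Subgroup ℚˣ) : radicalGroup Γ →* radicalField Γ where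
  toFun := toField
  map_one' := rfl
  map_mul' _ _ := rfl

theorem toField_mul (x y : radicalGroup Γ) : toField (x * y) = toField x * toField y := rfl

theorem toField_one : toField (1 : radicalGroup Γ) = 1 := rfl

theorem toField_pow (x : radicalGroup Γ) (m : ℕ) : toField (x ^ m) = toField x ^ m :=
  map_pow (toFieldHom Γ) x m

theorem toField_ne_zero (x : radicalGroup Γ) : toField x ≠ 0 :=
  ((Group.isUnit x).map (toFieldHom Γ)).ne_zero

theorem toField_inv (x : radicalGroup Γ) : toField x⁻¹ = (toField x)⁻¹ :=
  eq_inv_of_mul_eq_one_left (by rw [← toField_mul, inv_mul_cancel, toField_one])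

theorem toField_div (x y : radicalGroup Γ) : toField (x / y) = toField x / toField y := by
  rw [div_eq_mul_inv, toField_mul, toField_inv, div_eq_mul_inv]

theorem coe_toField (x : radicalGroup Γ) : ((toField x : radicalField Γ) : ℂ) = ((x : ℂˣ) : ℂ) :=
  rfl

theorem ratUnits_coe (q : ℚˣ) : ((ratUnits q : ℂˣ) : ℂ) = ((q : ℚ) : ℂ) := rfl

theorem ratUnits_injective : Function.Injective ratUnits :=
  Units.map_injective (algebraMap ℚ ℂ).injective

theorem toField_eq_algebraMap_iff {x : radicalGroup Γ} {q : ℚˣ} :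
    toField x = algebraMap ℚ (radicalField Γ) q ↔ (x : ℂˣ) = ratUnits q := by
  constructor
  · intro h
    exact Units.ext (congrArg (fun z : radicalField Γ => (z : ℂ)) h)
  · intro h
    exact Subtype.ext (congrArg Units.val h)

theorem toField_mem_range_iff {x : radicalGroup Γ} :
    toField x ∈ Set.range (algebraMap ℚ (radicalField Γ)) ↔ (x : ℂˣ) ∈ ratUnits.range := by
  constructor
  · rintro ⟨q, hq⟩
    have hq0 : q ≠ 0 := by
      rintro rfl
      exact toField_ne_zero x (by rw [← hq, map_zero])
    exact ⟨Units.mk0 q hq0, (toField_eq_algebraMap_iff.1 hq.symm).symm⟩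
  · rintro ⟨q, hq⟩
    exact ⟨q, (toField_eq_algebraMap_iff.2 hq.symm).symm⟩

theorem exists_pow_eq_ratUnits (x : radicalGroup Γ) :
    ∃ m : ℕ, 1 ≤ m ∧ ∃ q ∈ Γ, (x : ℂˣ) ^ m = ratUnits q := by
  obtain ⟨x, m, hm, q, hq, hx⟩ := x
  exact ⟨m, hm, q, hq, hx.symm⟩

theorem mem_radicalGroup_of_pow {x : ℂˣ} {m : ℕ} (hm : 1 ≤ m) {q : ℚˣ} (hq : q ∈ Γ)
    (hx : x ^ m = ratUnits q) : x ∈ radicalGroup Γ := ⟨m, hm, q, hq, hx.symm⟩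

theorem mem_radicalGroup_of_pow_eq_one {x : ℂˣ} {m : ℕ} (hm : 1 ≤ m) (hx : x ^ m = 1) :
    x ∈ radicalGroup Γ := mem_radicalGroup_of_pow hm Γ.one_mem (by rw [hx, map_one])

theorem exists_isPrimitiveRoot (Γ : Subgroup ℚˣ) {m : ℕ} (hm : 1 ≤ m) :
    ∃ z : radicalGroup Γ, IsPrimitiveRoot z m := by
  have hm0 : m ≠ 0 := by omega
  let ζ : ℂˣ := (Complex.isPrimitiveRoot_exp m hm0).isUnit hm0 |>.unit
  have hζ : IsPrimitiveRoot ζ m := IsPrimitiveRoot.coe_units_iff.1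
    (Complex.isPrimitiveRoot_exp m hm0)
  exact ⟨⟨ζ, mem_radicalGroup_of_pow_eq_one hm hζ.pow_eq_one⟩,
    hζ.of_map_of_injective (f := (radicalGroup Γ).subtype) Subtype.val_injective⟩

/-- `ℚ(Γ_∞)` is generated by the roots of polynomials `X ^ m - q`, which split since `Γ_∞` contains all
roots of unity. -/
instance radicalField_isGalois (Γ : Subgroup ℚˣ) : IsGalois ℚ (radicalField Γ) := by
  have key : ∀ x ∈ ((fun x : ℂˣ => (x : ℂ)) '' (radicalGroup Γ : Set ℂˣ)), IsIntegral ℚ x ∧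
      ((minpoly ℚ x).map (algebraMap ℚ (radicalField Γ))).Splits := by
    rintro _ ⟨x, hx, rfl⟩
    obtain ⟨m, hm, q, hq, hxq⟩ := exists_pow_eq_ratUnits (⟨x, hx⟩ : radicalGroup Γ)
    have hm0 : m ≠ 0 := by omega
    have hpow : (x : ℂ) ^ m = algebraMap ℚ ℂ q := congrArg Units.val hxq
    have hne : (Polynomial.X ^ m - Polynomial.C (q : ℚ)) ≠ 0 :=
      Polynomial.X_pow_sub_C_ne_zero hm _
    have hroot : Polynomial.aeval (x : ℂ) (Polynomial.X ^ m - Polynomial.C (q : ℚ)) = 0 := by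
      simp [hpow]
    refine ⟨⟨_, Polynomial.monic_X_pow_sub_C _ hm0, by simpa using hroot⟩, ?_⟩
    have hdvd := minpoly.dvd ℚ (x : ℂ) hroot
    obtain ⟨z, hz⟩ := exists_isPrimitiveRoot Γ hm
    have hs := X_pow_sub_C_splits_of_isPrimitiveRoot
      (hz.map_of_injective (f := toFieldHom Γ) toField_injective)
      (α := toField (⟨x, hx⟩ : radicalGroup Γ)) (a := algebraMap ℚ (radicalField Γ) q)
      (Subtype.ext hpow)
    refine Polynomial.Splits.of_dvd ?_ ?_ (Polynomial.map_dvd (algebraMap ℚ (radicalField Γ)) hdvd)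
    · simpa using hs
    · simpa using Polynomial.map_ne_zero (f := algebraMap ℚ (radicalField Γ)) hne
  have halg : Algebra.IsAlgebraic ℚ (radicalField Γ) :=
    IntermediateField.isAlgebraic_adjoin fun x hx => (key x hx).1
  have hnormal : Normal ℚ (radicalField Γ) := by
    refine normal_iff.2 fun x => ⟨Algebra.IsIntegral.isIntegral x, ?_⟩
    have := IntermediateField.splits_of_mem_adjoin _ _ key x.2
    rwa [show minpoly ℚ x = minpoly ℚ (x : ℂ) from
      (minpoly.algebraMap_eq (algebraMap (radicalField Γ) ℂ).injective x).symm]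
  exact ⟨⟩

theorem algEquiv_toField_mem (σ : radicalField Γ ≃ₐ[ℚ] radicalField Γ) (x : radicalGroup Γ) :
    ∃ y : radicalGroup Γ, toField y = σ (toField x) := by
  obtain ⟨m, hm, q, hq, hx⟩ := exists_pow_eq_ratUnits x
  have hne : ((σ (toField x) : radicalField Γ) : ℂ) ≠ 0 := by
    simpa using toField_ne_zero x
  refine ⟨⟨Units.mk0 _ hne, mem_radicalGroup_of_pow hm hq ?_⟩, rfl⟩
  ext
  have h : toField (x ^ m) = algebraMap ℚ (radicalField Γ) q :=
    toField_eq_algebraMap_iff.2 (by simpa using hx)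
  have h2 : σ (toField x) ^ m = algebraMap ℚ (radicalField Γ) q := by
    rw [← map_pow, ← toField_pow, h, AlgEquiv.commutes]
  exact congrArg Subtype.val h2

/-- The action of a field automorphism of `ℚ(Γ_∞)` on an element of `Γ_∞`. -/
def galAct (σ : radicalField Γ ≃ₐ[ℚ] radicalField Γ) (x : radicalGroup Γ) : radicalGroup Γ :=
  (algEquiv_toField_mem σ x).choose

theorem toField_galAct (σ : radicalField Γ ≃ₐ[ℚ] radicalField Γ) (x : radicalGroup Γ) :
    toField (galAct σ x) = σ (toField x) := (algEquiv_toField_mem σ x).choose_spec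

/-- The restriction homomorphism `Gal(ℚ(Γ_∞)/ℚ) → A`. -/
def galRestrict (Γ : Subgroup ℚˣ) : (radicalField Γ ≃ₐ[ℚ] radicalField Γ) →* radAut Γ where
  toFun σ :=
    ⟨{ toFun := galAct σ
       invFun := galAct σ⁻¹
       left_inv := fun x => toField_injective (by
        rw [toField_galAct, toField_galAct, ← AlgEquiv.mul_apply, inv_mul_cancel,
          AlgEquiv.one_apply])
       right_inv := fun x => toField_injective (by
        rw [toField_galAct, toField_galAct, ← AlgEquiv.mul_apply, mul_inv_cancel,
          AlgEquiv.one_apply])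
       map_mul' := fun x y => toField_injective (by
        rw [toField_galAct, toField_mul, toField_mul, map_mul, toField_galAct, toField_galAct]) },
      fun x hx => by
        obtain ⟨q, hq⟩ := toField_mem_range_iff.2 hx
        refine toField_injective ((toField_galAct σ x).trans ?_)
        rw [← hq, AlgEquiv.commutes]⟩
  map_one' := Subtype.ext (MulEquiv.ext fun x => toField_injective (toField_galAct 1 x))
  map_mul' σ τ := Subtype.ext (MulEquiv.ext fun x => toField_injective (by
    change toField (galAct (σ * τ) x) = toField (galAct σ (galAct τ x))
    rw [toField_galAct, toField_galAct, toField_galAct, AlgEquiv.mul_apply]))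

theorem toField_act_galRestrict (σ : radicalField Γ ≃ₐ[ℚ] radicalField Γ) (x : radicalGroup Γ) :
    toField (act (galRestrict Γ σ) x) = σ (toField x) := toField_galAct σ x

theorem act_mul (α β : radAut Γ) (x : radicalGroup Γ) : act (α * β) x = act α (act β x) := rfl

theorem act_map_mul (α : radAut Γ) (x y : radicalGroup Γ) : act α (x * y) = act α x * act α y :=
  map_mul α.1 x y

theorem act_map_pow (α : radAut Γ) (x : radicalGroup Γ) (m : ℕ) :
    act α (x ^ m) = act α x ^ m := map_pow α.1 x m

theorem act_injective (α : radAut Γ) : Function.Injective (act α) := α.1.injective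

theorem act_inv_eq_iff {α : radAut Γ} {x y : radicalGroup Γ} :
    act α⁻¹ x = y ↔ x = act α y := MulEquiv.symm_apply_eq _

theorem act_one (x : radicalGroup Γ) : act (1 : radAut Γ) x = x := rfl

theorem radAut_ext {α β : radAut Γ} (h : ∀ x, act α x = act β x) : α = β :=
  Subtype.ext (MulEquiv.ext h)

theorem galoisImage_eq_range (Γ : Subgroup ℚˣ) :
    galoisImage Γ = ((galRestrict Γ).range : Set (radAut Γ)) := by
  ext α
  constructor
  · rintro ⟨σ, hσ⟩
    exact ⟨σ, radAut_ext fun x => toField_injective ((toField_act_galRestrict σ x).trans (hσ x))⟩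
  · rintro ⟨σ, rfl⟩
    exact ⟨σ, fun x => (toField_act_galRestrict σ x).symm⟩

instance radAut_t2Space (Γ : Subgroup ℚˣ) : T2Space (radAut Γ) := by
  refine ⟨fun α β hne => ?_⟩
  obtain ⟨x, hx⟩ : ∃ x, act α x ≠ act β x := by
    by_contra! h
    exact hne (radAut_ext h)
  refine ⟨_, _, isOpen_act_eq x (act α x), isOpen_act_eq x (act β x), rfl, rfl, ?_⟩
  rw [Set.disjoint_left]
  intro γ h1 h2
  exact hx (h1.symm.trans h2)

theorem isClosed_act_eq (x y : radicalGroup Γ) : IsClosed {α : radAut Γ | act α x = y} := by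
  have : {α : radAut Γ | act α x = y}ᶜ = ⋃ z : {z // z ≠ y}, {α | act α x = z} := by
    ext α
    simp
  rw [← isOpen_compl_iff, this]
  exact isOpen_iUnion fun z => isOpen_act_eq x z

theorem isOpen_algEquiv_eq (x y : radicalField Γ) :
    IsOpen {σ : radicalField Γ ≃ₐ[ℚ] radicalField Γ | σ x = y} := by
  by_cases h : ∃ σ : radicalField Γ ≃ₐ[ℚ] radicalField Γ, σ x = y
  · obtain ⟨σ₀, rfl⟩ := h
    have hfin : FiniteDimensional ℚ (IntermediateField.adjoin ℚ {x}) :=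
      IntermediateField.adjoin.finiteDimensional (Algebra.IsIntegral.isIntegral x)
    have hopen := (IntermediateField.fixingSubgroup_isOpen
      (IntermediateField.adjoin ℚ {x})).leftCoset σ₀
    convert hopen using 1
    ext σ
    rw [Set.mem_smul_set_iff_inv_smul_mem]
    change σ x = σ₀ x ↔ σ₀⁻¹ * σ ∈ (IntermediateField.adjoin ℚ {x}).fixingSubgroup
    rw [IntermediateField.mem_fixingSubgroup_iff]
    constructor
    · intro hσ y hy
      have : IntermediateField.adjoin ℚ {x} ≤
          IntermediateField.fixedField (Subgroup.zpowers (σ₀⁻¹ * σ)) := by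
        rw [IntermediateField.adjoin_simple_le_iff, IntermediateField.mem_fixedField_iff]
        intro f hf
        have hf' : Subgroup.zpowers (σ₀⁻¹ * σ) ≤ MulAction.stabilizer _ x := by
          rw [Subgroup.zpowers_le, MulAction.mem_stabilizer_iff]
          change σ₀⁻¹ (σ x) = x
          rw [hσ, ← AlgEquiv.mul_apply, inv_mul_cancel, AlgEquiv.one_apply]
        exact hf' hf
      exact (IntermediateField.mem_fixedField_iff _ _).1 (this hy) _ (Subgroup.mem_zpowers _)
    · intro hσ
      have := hσ x (IntermediateField.mem_adjoin_simple_self ℚ x)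
      rw [AlgEquiv.mul_apply] at this
      rw [← this, ← AlgEquiv.mul_apply σ₀, mul_inv_cancel, AlgEquiv.one_apply, this]
  · convert isOpen_empty
    rw [Set.eq_empty_iff_forall_notMem]
    exact fun σ hσ => h ⟨σ, hσ⟩

theorem continuous_galRestrict (Γ : Subgroup ℚˣ) : Continuous (galRestrict Γ) := by
  refine continuous_into _ fun x y => ?_
  have : {σ | act (galRestrict Γ σ) x = y} = {σ | σ (toField x) = toField y} := by
    ext σ
    change _ = _ ↔ _ = _
    rw [← toField_act_galRestrict, toField_injective.eq_iff]
  rw [this]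
  exact isOpen_algEquiv_eq _ _

/-- The Galois group is closed in `A`, as the continuous image of a compact group. -/
theorem isClosed_galRestrict_range (Γ : Subgroup ℚˣ) :
    IsClosed ((galRestrict Γ).range : Set (radAut Γ)) := by
  rw [MonoidHom.coe_range]
  exact (isCompact_range (continuous_galRestrict Γ)).isClosed

end GaloisAction

/-! ### Radicals over the maximal cyclotomic field -/

section Galois

variable {Γ : Subgroup ℚˣ}

/-- Galois automorphisms raise the `N`-th roots of unity to any prescribed power prime to `N`. -/
theorem exists_galois_pow (Γ : Subgroup ℚˣ) {N u : ℕ} (hN : 1 ≤ N) (hu : u.Coprime N) :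
    ∃ σ : radicalField Γ ≃ₐ[ℚ] radicalField Γ, ∀ z : radicalGroup Γ, z ^ N = 1 →
      act (galRestrict Γ σ) z = z ^ u := by
  obtain ⟨ζ, hζ⟩ := exists_isPrimitiveRoot Γ hN
  have hζ' : IsPrimitiveRoot (toField ζ) N :=
    hζ.map_of_injective (f := toFieldHom Γ) toField_injective
  obtain ⟨σ, hσ⟩ := minpoly.exists_algEquiv_of_root' (K := ℚ) (x := toField ζ ^ u)
    (y := toField ζ) (Algebra.IsAlgebraic.isAlgebraic _) (by
      rw [minpoly.isIntegrallyClosed_eq_field_fractions' ℚ (hζ'.isIntegral (by omega))]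
      have := hζ'.pow_isRoot_minpoly hu
      rw [Polynomial.IsRoot.def, Polynomial.eval_map] at this
      rw [Polynomial.aeval_map_algebraMap, Polynomial.aeval_def]
      exact this)
  refine ⟨σ, fun z hz => ?_⟩
  have : NeZero N := ⟨by omega⟩
  obtain ⟨i, -, hi⟩ := hζ'.eq_pow_of_pow_eq_one (ξ := toField z) (by
    rw [← toField_pow, hz, toField_one])
  rw [← toField_pow] at hi
  rw [← toField_injective hi]
  apply toField_injective
  rw [toField_act_galRestrict, toField_pow, map_pow, hσ, ← pow_mul, toField_pow, toField_pow,
    ← pow_mul, mul_comm]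

/-- The subfield `ℚ(μ_∞)` of `ℚ(Γ_∞)`. -/
def cyclotomicSubfield (Γ : Subgroup ℚˣ) : IntermediateField ℚ (radicalField Γ) :=
  IntermediateField.adjoin ℚ (toField '' {z : radicalGroup Γ | IsOfFinOrder z})

theorem toField_mem_cyclotomicSubfield {z : radicalGroup Γ} (hz : IsOfFinOrder z) :
    toField z ∈ cyclotomicSubfield Γ := IntermediateField.subset_adjoin _ _ ⟨z, hz, rfl⟩

theorem eq_on_cyclotomicSubfield (f g : radicalField Γ →ₐ[ℚ] radicalField Γ)
    (h : ∀ z : radicalGroup Γ, IsOfFinOrder z → f (toField z) = g (toField z))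
    {x : radicalField Γ} (hx : x ∈ cyclotomicSubfield Γ) : f x = g x := by
  let E : IntermediateField ℚ (radicalField Γ) := (AlgHom.equalizer f g).toIntermediateField
    fun x hx => by
      have hx' : f x = g x := hx
      change f x⁻¹ = g x⁻¹
      rw [map_inv₀, map_inv₀, hx']
  have : cyclotomicSubfield Γ ≤ E := by
    refine IntermediateField.adjoin_le_iff.2 ?_
    rintro _ ⟨z, hz, rfl⟩
    exact h z hz
  exact this hx

theorem isOfFinOrder_coe {z : radicalGroup Γ} (hz : IsOfFinOrder z) : ‖((z : ℂˣ) : ℂ)‖ = 1 := by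
  obtain ⟨m, hm, h⟩ := isOfFinOrder_iff_pow_eq_one.1 hz
  refine Complex.norm_eq_one_of_pow_eq_one (n := m) ?_ (by omega)
  exact congrArg (fun w : radicalGroup Γ => ((w : ℂˣ) : ℂ)) h

/-- Complex conjugation on `ℚ(Γ_∞)`. -/
def conjAut (Γ : Subgroup ℚˣ) : radicalField Γ ≃ₐ[ℚ] radicalField Γ :=
  (Complex.conjAe.restrictScalars ℚ).restrictNormal (radicalField Γ)

theorem coe_conjAut (x : radicalField Γ) : ((conjAut Γ x : radicalField Γ) : ℂ) =
    (starRingEnd ℂ) (x : ℂ) :=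
  AlgEquiv.restrictNormal_commutes (Complex.conjAe.restrictScalars ℚ) (radicalField Γ) x

/-- Every element of `Γ_∞` is a root of unity times its absolute value, which is in `Γ_∞`. -/
theorem exists_polar (x : radicalGroup Γ) : ∃ z r : radicalGroup Γ, IsOfFinOrder z ∧
    x = z * r ∧ ((r : ℂˣ) : ℂ) = (‖((x : ℂˣ) : ℂ)‖ : ℝ) := by
  obtain ⟨m, hm, q, hq, hx⟩ := exists_pow_eq_ratUnits x
  have hne : ((‖((x : ℂˣ) : ℂ)‖ : ℝ) : ℂ) ≠ 0 := by simp
  have hx' : ((x : ℂˣ) : ℂ) ^ m = ((q : ℚ) : ℂ) := congrArg Units.val hx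
  have hr : (Units.mk0 _ hne) ^ (2 * m) = ratUnits (q ^ 2) := by
    ext
    have h1 : ‖((x : ℂˣ) : ℂ)‖ ^ m = |((q : ℚ) : ℝ)| := by
      rw [← norm_pow, hx', ← Complex.ofReal_ratCast, Complex.norm_real, Real.norm_eq_abs]
    have h2 : ‖((x : ℂˣ) : ℂ)‖ ^ (2 * m) = ((q : ℚ) : ℝ) ^ 2 := by
      rw [mul_comm, pow_mul, h1, sq_abs]
    rw [ratUnits_coe]
    push_cast
    simp only [Units.val_mk0]
    exact_mod_cast congrArg (fun t : ℝ => (t : ℂ)) h2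
  let r : radicalGroup Γ := ⟨Units.mk0 _ hne,
    mem_radicalGroup_of_pow (by omega) (pow_mem hq 2) hr⟩
  refine ⟨x / r, r, isOfFinOrder_iff_pow_eq_one.2 ⟨2 * m, by omega, ?_⟩, by simp, rfl⟩
  rw [div_pow, div_eq_one]
  refine Subtype.ext ?_
  change (x : ℂˣ) ^ (2 * m) = (Units.mk0 _ hne) ^ (2 * m)
  rw [hr, mul_comm, pow_mul, hx, map_pow]

/-- An element of `Γ_∞` contained in `ℚ(μ_∞)` is a root of unity times the square root of a
rational number: all conjugates of its absolute value `r` are real, because complex conjugation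
commutes with the Galois group on the abelian extension `ℚ(μ_∞)` of `ℚ`, so that they are
equal to `r` or `-r`. -/
theorem eq_rootOfUnity_mul_sqrt {x : radicalGroup Γ} (hx : toField x ∈ cyclotomicSubfield Γ) :
    ∃ z y : radicalGroup Γ, IsOfFinOrder z ∧ ((y ^ 2 : radicalGroup Γ) : ℂˣ) ∈ ratUnits.range ∧
      x = z * y := by
  obtain ⟨z, r, hz, hxr, hr⟩ := exists_polar x
  refine ⟨z, r, hz, ?_, hxr⟩
  have hrK : toField r ∈ cyclotomicSubfield Γ := by
    have : r = x * z⁻¹ := by rw [hxr, mul_comm z, mul_inv_cancel_right]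
    rw [this, toField_mul]
    exact mul_mem hx (toField_mem_cyclotomicSubfield hz.inv)
  have hfix : ∀ z : radicalGroup Γ, IsOfFinOrder z → conjAut Γ (toField z) = (toField z)⁻¹ := by
    intro z hz
    refine Subtype.ext ?_
    rw [coe_conjAut]
    change _ = (((z : ℂˣ) : ℂ))⁻¹
    rw [Complex.inv_eq_conj (isOfFinOrder_coe hz), coe_toField]
  rw [← toField_mem_range_iff]
  apply mem_range_algebraMap_of_fixed
  intro τ
  have hcomm : conjAut Γ (τ (toField r)) = τ (conjAut Γ (toField r)) := by
    refine eq_on_cyclotomicSubfield ((conjAut Γ : radicalField Γ →ₐ[ℚ] radicalField Γ).comp τ)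
      ((τ : radicalField Γ →ₐ[ℚ] radicalField Γ).comp (conjAut Γ)) (fun z hz => ?_) hrK
    change conjAut Γ (τ (toField z)) = τ (conjAut Γ (toField z))
    rw [hfix z hz, map_inv₀, ← toField_act_galRestrict, hfix]
    exact (MonoidHom.isOfFinOrder ((galRestrict Γ τ).1 : radicalGroup Γ →* radicalGroup Γ) hz)
  have hrreal : conjAut Γ (toField r) = toField r := by
    refine Subtype.ext ?_
    rw [coe_conjAut, coe_toField, hr, Complex.conj_ofReal]
  rw [hrreal] at hcomm
  -- A real element `w` satisfies `w ^ 2 = ‖w‖ ^ 2`, and conjugate radicals have the same norm.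
  have hsq : ∀ w : radicalField Γ, conjAut Γ w = w → (w : ℂ) ^ 2 = ((‖(w : ℂ)‖ ^ 2 : ℝ) : ℂ) := by
    intro w hw
    have := congrArg (fun t : radicalField Γ => (t : ℂ)) hw
    simp only [coe_conjAut] at this
    have h2 := Complex.mul_conj (w : ℂ)
    rw [this] at h2
    rw [sq, h2, Complex.normSq_eq_norm_sq]
  obtain ⟨m, hm, q, hq, hrq⟩ := exists_pow_eq_ratUnits r
  have hrq' : toField r ^ m = algebraMap ℚ _ (q : ℚ) := by
    rw [← toField_pow]
    exact toField_eq_algebraMap_iff.2 (by simpa using hrq)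
  have hτ : τ (toField r) ^ m = toField r ^ m := by rw [← map_pow, hrq', AlgEquiv.commutes]
  have hnorm : ‖(τ (toField r) : ℂ)‖ = ‖(toField r : ℂ)‖ := by
    refine (pow_left_inj₀ (norm_nonneg _) (norm_nonneg _) (by omega : m ≠ 0)).1 ?_
    rw [← norm_pow, ← norm_pow]
    exact congrArg (fun t : radicalField Γ => ‖(t : ℂ)‖) hτ
  refine Subtype.ext ?_
  rw [toField_pow, map_pow]
  change (τ (toField r) : ℂ) ^ 2 = (toField r : ℂ) ^ 2
  rw [hsq _ hcomm, hsq _ hrreal, hnorm]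

/-- Kummer theory over `ℚ(μ_∞)`: a homomorphism `β` on a group `B` of radicals extends to a Galois
automorphism over `ℚ(μ_∞)` if it is the identity on the radicals of the form `ζ √q`. -/
theorem exists_galois_of_monoidHom {B : Type*} [CommGroup B] (j β : B →* radicalGroup Γ)
    (h : ∀ b (z y : radicalGroup Γ), IsOfFinOrder z →
      ((y ^ 2 : radicalGroup Γ) : ℂˣ) ∈ ratUnits.range → j b = z * y → β b = j b) :
    ∃ σ : radicalField Γ ≃ₐ[ℚ] radicalField Γ,
      (∀ z, IsOfFinOrder z → act (galRestrict Γ σ) z = z) ∧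
      ∀ b, act (galRestrict Γ σ) (j b) = β b := by
  have hmem : ∀ x, x ∈ Set.range (algebraMap (cyclotomicSubfield Γ) (radicalField Γ)) ↔
      x ∈ cyclotomicSubfield Γ := fun x => ⟨by rintro ⟨y, rfl⟩; exact y.2, fun h => ⟨⟨x, h⟩, rfl⟩⟩
  obtain ⟨τ, hτ⟩ := exists_algEquiv_of_monoidHom (F := cyclotomicSubfield Γ)
    ((toFieldHom Γ).comp j) ((toFieldHom Γ).comp β) (by
      intro τ b
      rw [hmem]
      change τ (toField (j b)) / toField (j b) ∈ _
      rw [show τ (toField (j b)) = τ.restrictScalars ℚ (toField (j b)) from rfl,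
        ← toField_act_galRestrict, ← toField_div]
      apply toField_mem_cyclotomicSubfield
      obtain ⟨m, hm, q, hq, hx⟩ := exists_pow_eq_ratUnits (j b)
      refine isOfFinOrder_iff_pow_eq_one.2 ⟨m, by omega, ?_⟩
      rw [div_pow, div_eq_one, ← act_map_pow]
      exact (galRestrict Γ _).2 _ ⟨q, by simpa using hx.symm⟩) (by
      intro b hb
      obtain ⟨z, y, hz, hy, hb'⟩ := eq_rootOfUnity_mul_sqrt ((hmem _).1 hb)
      exact congrArg toField (h b z y hz hy hb'))
  refine ⟨τ.restrictScalars ℚ, fun z hz => ?_, fun b => ?_⟩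
  · apply toField_injective
    rw [toField_act_galRestrict]
    exact τ.commutes ⟨_, toField_mem_cyclotomicSubfield hz⟩
  · apply toField_injective
    rw [toField_act_galRestrict]
    exact hτ b

/-- An element of `A` that is trivial on roots of unity and on square roots of rational numbers is
a Galois automorphism. -/
theorem mem_galRestrict_range_of_trivial {α : radAut Γ}
    (h1 : ∀ z, IsOfFinOrder z → act α z = z)
    (h2 : ∀ y : radicalGroup Γ, ((y ^ 2 : radicalGroup Γ) : ℂˣ) ∈ ratUnits.range → act α y = y) :
    α ∈ (galRestrict Γ).range := by
  obtain ⟨σ, -, hσ⟩ := exists_galois_of_monoidHom (MonoidHom.id (radicalGroup Γ))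
    (α.1 : radicalGroup Γ →* radicalGroup Γ) (by
      rintro b z y hz hy hb
      change act α b = b
      rw [show b = z * y from hb, act_map_mul, h1 z hz, h2 y hy])
  exact ⟨σ, radAut_ext hσ⟩

/-- The `p`-th power map `Γ'^{1/p} → Γ'`. -/
def rootPow (Γ' : Subgroup ℚˣ) (p : ℕ) : rootGroup Γ' p →* Γ' :=
  ((Γ'.equivMapOfInjective ratUnits ratUnits_injective).symm : Γ'.map ratUnits →* Γ').comp
    (((powMonoidHom p : ℂˣ →* ℂˣ).comp (rootGroup Γ' p).subtype).codRestrict (Γ'.map ratUnits)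
      fun x => x.2)

theorem ratUnits_rootPow {Γ' : Subgroup ℚˣ} {p : ℕ} (z : rootGroup Γ' p) :
    ratUnits (rootPow Γ' p z : ℚˣ) = (z : ℂˣ) ^ p := by
  have := (Γ'.equivMapOfInjective ratUnits ratUnits_injective).apply_symm_apply
    ⟨(z : ℂˣ) ^ p, z.2⟩
  exact congrArg Subtype.val this

theorem rootGroup_le {Γ' : Subgroup ℚˣ} (hΓ : Γ' ≤ Γ) {p : ℕ} (hp : 1 ≤ p) :
    rootGroup Γ' p ≤ radicalGroup Γ := fun _ hx => ⟨p, hp, Subgroup.map_mono hΓ hx⟩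

/-- If a rational number `γ` has a `p`-th root in `Γ_∞` of the form `ζ √q` with a root of unity `ζ`
and a rational number `q`, where `p` is odd, then `γ` is a `p`-th power. -/
theorem exists_eq_pow_of_rootOfUnity_mul_sqrt {p : ℕ} (hp : Odd p) {γ : ℚˣ}
    {z y : radicalGroup Γ} (hz : IsOfFinOrder z)
    (hy : ((y ^ 2 : radicalGroup Γ) : ℂˣ) ∈ ratUnits.range)
    (h : ((z * y : radicalGroup Γ) : ℂˣ) ^ p = ratUnits γ) : ∃ b : ℚˣ, γ = b ^ p := by
  obtain ⟨q, hq⟩ := hy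
  have h2 : ((z : ℂˣ)) ^ (2 * p) = ratUnits (γ ^ 2 / q ^ p) := by
    rw [map_div, map_pow, map_pow, ← h, hq]
    push_cast
    rw [mul_pow, mul_pow, ← pow_mul, ← pow_mul, ← pow_mul, mul_comm p 2, mul_div_cancel_right]
  have hfin : IsOfFinOrder (γ ^ 2 / q ^ p) := by
    have h3 : IsOfFinOrder ((z : ℂˣ) ^ (2 * p)) :=
      (MonoidHom.isOfFinOrder (radicalGroup Γ).subtype hz).pow
    rw [h2] at h3
    exact (ratUnits_injective.isOfFinOrder_iff (f := ratUnits)).1 h3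
  have hpm : γ ^ 2 / q ^ p = 1 ∨ γ ^ 2 / q ^ p = -1 := by
    obtain ⟨m, hm, h⟩ := isOfFinOrder_iff_pow_eq_one.1 hfin
    have h' := congrArg (fun t : ℚˣ => |(t : ℚ)|) h
    simp only [Units.val_pow_eq_pow_val, abs_pow, Units.val_one, abs_one] at h'
    have := (pow_eq_one_iff_of_nonneg (abs_nonneg _) (by omega)).1 h'
    rcases eq_or_eq_neg_of_abs_eq this with h | h
    · exact Or.inl (Units.ext h)
    · exact Or.inr (Units.ext h)
  obtain ⟨s, hs⟩ : ∃ s : ℚˣ, γ ^ 2 = s ^ p := by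
    rcases hpm with h | h
    · exact ⟨q, div_eq_one.1 h⟩
    · exact ⟨-q, by rw [hp.neg_pow, ← neg_one_mul, ← h, div_mul_cancel]⟩
  obtain ⟨k, rfl⟩ := hp
  refine ⟨s ^ (k + 1) / γ, ?_⟩
  rw [div_pow, ← pow_mul, mul_comm, pow_mul, ← hs, eq_div_iff_mul_eq', ← pow_mul, ← pow_succ']
  congr 1

/-- Kummer theory for `p`-th roots of the elements of a subgroup `Γ'` of `Γ`, for odd `p`: since
`ℚ(μ_∞)` contains no `p`-th roots of rational numbers other than the obvious ones, a homomorphism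
on `Γ'^{1/p}` comes from the Galois group of `ℚ(μ_∞)` as soon as it fixes the roots
of `p`-th powers of rational numbers. -/
theorem exists_galois_of_rootGroupHom {Γ' : Subgroup ℚˣ} (hΓ : Γ' ≤ Γ) {p : ℕ} (hp : Odd p)
    (β : rootGroup Γ' p →* radicalGroup Γ)
    (hβ : ∀ (x : rootGroup Γ' p) (b : ℚˣ), (x : ℂˣ) ^ p = ratUnits (b ^ p) →
      (β x : ℂˣ) = x) :
    ∃ σ : radicalField Γ ≃ₐ[ℚ] radicalField Γ,
      (∀ z, IsOfFinOrder z → act (galRestrict Γ σ) z = z) ∧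
      ∀ (x : radicalGroup Γ) (hx : (x : ℂˣ) ∈ rootGroup Γ' p),
        act (galRestrict Γ σ) x = β ⟨x, hx⟩ := by
  have hle : rootGroup Γ' p ≤ radicalGroup Γ := rootGroup_le hΓ hp.pos
  obtain ⟨σ, h1, h2⟩ := exists_galois_of_monoidHom (Subgroup.inclusion hle) β (by
    intro x z y hz hy hx
    obtain ⟨b, hb⟩ := exists_eq_pow_of_rootOfUnity_mul_sqrt hp (γ := rootPow Γ' p x) hz hy (by
      rw [← hx, ratUnits_rootPow]
      rfl)
    exact Subtype.ext (hβ x b (by rw [← hb, ratUnits_rootPow])))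
  exact ⟨σ, h1, fun x hx => h2 ⟨x, hx⟩⟩

/-- If no product of an odd number of the `a_i` is a square, some Galois automorphism
changes the sign of all square roots of the `a_i`: on the square roots of elements of `⟨a_i⟩` it acts
through `w_2`. -/
theorem exists_galois_neg_sqrt (Γ : Subgroup ℚˣ) {m : ℕ} {a : Fin m → ℚˣ} (h : NoOddSquare a) :
    ∃ σ : radicalField Γ ≃ₐ[ℚ] radicalField Γ, ∀ (i : Fin m) (x : radicalField Γ),
      x ^ 2 = algebraMap ℚ _ (a i : ℚ) → σ x = -x := by
  let f : ℚˣ →* (radicalField Γ)ˣ := Units.map (algebraMap ℚ (radicalField Γ) : ℚ →* _)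
  have hf : Function.Injective f := Units.map_injective (algebraMap ℚ (radicalField Γ)).injective
  let B : Subgroup (radicalField Γ)ˣ := ((genGroup a).map f).comap (powMonoidHom 2)
  let e := (genGroup a).equivMapOfInjective f hf
  let sq : B →* genGroup a := (e.symm : (genGroup a).map f →* genGroup a).comp
    (((powMonoidHom 2).comp B.subtype).codRestrict ((genGroup a).map f) fun x => x.2)
  have hsq : ∀ b : B, f (sq b : ℚˣ) = (b : (radicalField Γ)ˣ) ^ 2 := by
    intro b
    have hb : (b : (radicalField Γ)ˣ) ^ 2 ∈ (genGroup a).map f := b.2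
    exact congrArg Subtype.val (e.apply_symm_apply ⟨_, hb⟩)
  let cl : genGroup a →* barGroup (genGroup a) 2 := (classMap 2).subgroupMap (genGroup a)
  let w : barGroup (genGroup a) 2 →* radicalField Γ :=
    ((Int.castRingHom (radicalField Γ) : ℤ →* radicalField Γ).comp (Units.coeHom ℤ)).comp (w2 a h)
  have hw2 : ∀ i, w2 a h (genClass a 2 i) = -1 := (existsUnique_w2 a h).choose_spec.1
  let ι : B →* radicalField Γ := (Units.coeHom _).comp B.subtype
  obtain ⟨σ, hσ⟩ := exists_algEquiv_of_monoidHom (F := ℚ) ι (ι * w.comp (cl.comp sq)) (by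
    intro τ b
    have hb : ι b ^ 2 = algebraMap ℚ _ ((sq b : ℚˣ) : ℚ) := (congrArg Units.val (hsq b)).symm
    have hb0 : ι b ≠ 0 := (b : (radicalField Γ)ˣ).ne_zero
    have : (τ (ι b)) ^ 2 = ι b ^ 2 := by rw [← map_pow, hb, AlgEquiv.commutes]
    rcases sq_eq_sq_iff_eq_or_eq_neg.1 this with h | h
    · exact ⟨1, by rw [h, div_self hb0, map_one]⟩
    · exact ⟨-1, by rw [h, neg_div, div_self hb0, map_neg, map_one]⟩) (by
    rintro b ⟨q, hq⟩
    have hq0 : q ≠ 0 := by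
      rintro rfl
      exact (b : (radicalField Γ)ˣ).ne_zero (by rw [map_zero] at hq; exact hq.symm)
    have h1 : (sq b : ℚˣ) = Units.mk0 q hq0 ^ 2 := by
      apply hf
      rw [hsq, map_pow]
      congr 1
      exact Units.ext hq.symm
    have h2 : cl (sq b) = 1 := by
      refine Subtype.ext ?_
      change classMap 2 (sq b : ℚˣ) = 1
      rw [h1]
      exact (QuotientGroup.eq_one_iff _).2 ⟨_, rfl⟩
    change ι b * w (cl (sq b)) = ι b
    rw [h2, map_one, mul_one])
  refine ⟨σ, fun i x hx => ?_⟩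
  have hx0 : x ≠ 0 := by
    rintro rfl
    have : (a i : ℚ) = 0 := by simpa using hx.symm
    exact (a i).ne_zero this
  have hxf : (Units.mk0 x hx0) ^ 2 = f (a i) := Units.ext hx
  let b : B := ⟨Units.mk0 x hx0, a i, Subgroup.subset_closure ⟨i, rfl⟩, hxf.symm⟩
  have hb : cl (sq b) = genClass a 2 i := by
    refine Subtype.ext ?_
    change classMap 2 (sq b : ℚˣ) = classMap 2 (a i)
    rw [show (sq b : ℚˣ) = a i from hf ((hsq b).trans hxf)]
  have h1 : σ x = x * w (cl (sq b)) := hσ b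
  rw [hb] at h1
  refine h1.trans ?_
  change x * ((w2 a h (genClass a 2 i) : ℤˣ) : ℤ) = -x
  rw [hw2]
  simp

end Galois

/-! ### Powers and square classes of rational numbers -/

section SquareClasses

/-- The rational numbers with a power in a finitely generated group fall into finitely many classes
modulo squares: only primes in numerators and denominators of the generators can divide them. -/
theorem finite_square_classes {n : ℕ} (a : Fin n → ℚˣ) : ∃ D : Finset ℚˣ,
    ∀ (q : ℚˣ) (m : ℕ), 1 ≤ m → q ^ m ∈ genGroup a → ∃ d ∈ D, ∃ t : ℚˣ, q = d * t ^ 2 := by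
  classical
  let N : ℕ := ∏ i, ((a i : ℚ).num.natAbs * (a i : ℚ).den)
  have hN : N ≠ 0 := Finset.prod_ne_zero_iff.2 fun i _ =>
    mul_ne_zero (Int.natAbs_ne_zero.2 (Rat.num_ne_zero.2 (a i).ne_zero)) (a i : ℚ).den_nz
  have hsmooth : ∀ γ ∈ genGroup a, ∃ (k : ℕ) (u v : ℤ), u ∣ (N : ℤ) ^ k ∧ v ∣ (N : ℤ) ^ k ∧
      (γ : ℚ) = u / v := by
    intro γ hγ
    induction hγ using Subgroup.closure_induction with
    | mem x hx =>
      obtain ⟨i, rfl⟩ := hx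
      have h1 : (a i : ℚ).num.natAbs * (a i : ℚ).den ∣ N :=
        Finset.dvd_prod_of_mem (fun i => (a i : ℚ).num.natAbs * (a i : ℚ).den) (Finset.mem_univ i)
      refine ⟨1, (a i : ℚ).num, (a i : ℚ).den, ?_, ?_, ?_⟩
      · rw [pow_one, ← Int.natAbs_dvd]
        exact_mod_cast (dvd_mul_right _ _).trans h1
      · rw [pow_one]
        exact_mod_cast (dvd_mul_left _ _).trans h1
      · exact_mod_cast (Rat.num_div_den (a i : ℚ)).symm
    | one => exact ⟨0, 1, 1, by simp, by simp, by simp⟩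
    | mul x y _ _ hx hy =>
      obtain ⟨k, u, v, hu, hv, hx⟩ := hx
      obtain ⟨k', u', v', hu', hv', hy⟩ := hy
      refine ⟨k + k', u * u', v * v', ?_, ?_, ?_⟩
      · rw [pow_add]; exact mul_dvd_mul hu hu'
      · rw [pow_add]; exact mul_dvd_mul hv hv'
      · push_cast
        rw [hx, hy, div_mul_div_comm]
    | inv x _ hx =>
      obtain ⟨k, u, v, hu, hv, hx⟩ := hx
      refine ⟨k, v, u, hv, hu, ?_⟩
      rw [Units.val_inv_eq_inv_val, hx, inv_div]
  let toU : ℤ → ℚˣ := fun c => if h : (c : ℚ) ≠ 0 then Units.mk0 c h else 1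
  have htoU : ∀ c : ℤ, c ≠ 0 → (toU c : ℚ) = c := by
    intro c hc
    have : (c : ℚ) ≠ 0 := by exact_mod_cast hc
    simp [toU, hc]
  refine ⟨(N.divisors.image fun d : ℕ => toU d) ∪ (N.divisors.image fun d : ℕ => toU (-d)), ?_⟩
  intro q m hm hq
  obtain ⟨k, u, v, hu, hv, hquv⟩ := hsmooth _ hq
  have hv0 : v ≠ 0 := by
    rintro rfl
    exact pow_ne_zero k (by exact_mod_cast hN : (N : ℤ) ≠ 0) (zero_dvd_iff.1 hv)
  have hnum : (q : ℚ).num ∣ (N : ℤ) ^ k := by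
    have : ((q : ℚ) ^ m).num ∣ u := by
      rw [← Units.val_pow_eq_pow_val, hquv, ← Rat.divInt_eq_div]
      exact Rat.num_dvd u hv0
    rw [Rat.num_pow] at this
    exact (dvd_pow_self _ (by omega)).trans (this.trans hu)
  have hden : ((q : ℚ).den : ℤ) ∣ (N : ℤ) ^ k := by
    have : (((q : ℚ) ^ m).den : ℤ) ∣ v := by
      rw [← Units.val_pow_eq_pow_val, hquv, ← Rat.divInt_eq_div]
      exact Rat.den_dvd u v
    rw [Rat.den_pow] at this
    push_cast at this
    exact (dvd_pow_self _ (by omega)).trans (this.trans hv)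
  obtain ⟨c, b, hcb, hc⟩ := Nat.sq_mul_squarefree ((q : ℚ).num.natAbs * (q : ℚ).den)
  have hnum0 : (q : ℚ).num ≠ 0 := Rat.num_ne_zero.2 q.ne_zero
  have hprod0 : (q : ℚ).num.natAbs * (q : ℚ).den ≠ 0 :=
    mul_ne_zero (Int.natAbs_ne_zero.2 hnum0) (q : ℚ).den_nz
  have hb0 : b ≠ 0 := by
    rintro rfl
    exact hprod0 (by rw [← hcb]; simp)
  have hcN : c ∣ N := by
    have h1 : c ∣ N ^ (k + k) := by
      refine (Dvd.intro_left _ hcb).trans ?_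
      rw [pow_add]
      refine mul_dvd_mul ?_ (by exact_mod_cast hden)
      have := Int.natAbs_dvd_natAbs.2 hnum
      simpa [Int.natAbs_pow] using this
    exact (hc.dvd_pow_iff_dvd (n := k + k + 1) (by omega)).1 (h1.trans (pow_dvd_pow _ (by omega)))
  have hc0 : (c : ℤ) ≠ 0 := by exact_mod_cast hc.ne_zero
  have ht : (b / (q : ℚ).den : ℚ) ≠ 0 := by
    have := (q : ℚ).den_nz
    positivity
  have hcb' : ((b : ℚ)) ^ 2 * c = |((q : ℚ).num : ℚ)| * (q : ℚ).den := by
    rw [← Int.cast_abs, Int.abs_eq_natAbs]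
    exact_mod_cast hcb
  have hden0 : ((q : ℚ).den : ℚ) ≠ 0 := by exact_mod_cast (q : ℚ).den_nz
  have hq' : (q : ℚ) = (q : ℚ).num / (q : ℚ).den := (Rat.num_div_den (q : ℚ)).symm
  have hmem : c ∈ N.divisors := Nat.mem_divisors.2 ⟨hcN, hN⟩
  rcases le_total 0 ((q : ℚ).num : ℚ) with hs | hs
  · refine ⟨toU c, Finset.mem_union_left _ (Finset.mem_image_of_mem _ hmem), Units.mk0 _ ht, ?_⟩
    ext
    push_cast
    rw [htoU _ hc0, Units.val_mk0, div_pow]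
    rw [abs_of_nonneg hs] at hcb'
    push_cast
    rw [mul_div_assoc', mul_comm (c : ℚ), hcb']
    nth_rewrite 1 [hq']
    field_simp
  · refine ⟨toU (-c), Finset.mem_union_right _ (Finset.mem_image_of_mem (fun d : ℕ => toU (-d)) hmem),
      Units.mk0 _ ht, ?_⟩
    ext
    push_cast
    rw [htoU _ (neg_ne_zero.2 hc0), Units.val_mk0, div_pow]
    rw [abs_of_nonpos hs] at hcb'
    push_cast
    rw [mul_div_assoc', neg_mul, mul_comm (c : ℚ), hcb']
    nth_rewrite 1 [hq']
    field_simp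

/-- A rational number different from `±1` is not a `p`-th power for large `p`. -/
theorem exists_forall_not_pow {a : ℚˣ} (h1 : a ≠ 1) (h2 : a ≠ -1) :
    ∃ P : ℕ, ∀ p, P ≤ p → ¬ ∃ b : ℚˣ, a = b ^ p := by
  refine ⟨(a : ℚ).num.natAbs * (a : ℚ).den, fun p hp => ?_⟩
  rintro ⟨b, rfl⟩
  rw [Units.val_pow_eq_pow_val, Rat.num_pow, Rat.den_pow, Int.natAbs_pow, ← mul_pow] at hp
  have hb0 : (b : ℚ).num.natAbs * (b : ℚ).den ≠ 0 :=
    mul_ne_zero (Int.natAbs_ne_zero.2 (Rat.num_ne_zero.2 b.ne_zero)) (b : ℚ).den_nz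
  by_cases hb : (b : ℚ).num.natAbs * (b : ℚ).den = 1
  · obtain ⟨hn, hd⟩ := mul_eq_one.1 hb
    have hb' : (b : ℚ) = (b : ℚ).num := by
      nth_rewrite 1 [← Rat.num_div_den (b : ℚ)]
      rw [hd]
      simp
    rcases Int.natAbs_eq_iff.1 hn with h | h
    · rw [h] at hb'
      have : b = 1 := Units.ext (by rw [hb']; simp)
      exact h1 (by rw [this, one_pow])
    · rw [h] at hb'
      have : b = -1 := Units.ext (by rw [hb']; simp)
      rw [this] at h1 h2
      rcases neg_one_pow_eq_or ℚˣ p with h | h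
      · exact h1 h
      · exact h2 h
  · exact absurd hp (not_le.2 (Nat.lt_pow_self (by omega)))

end SquareClasses

/-! ### Positivity of the Haar measure of Galois groups -/

section Haar

variable {Γ : Subgroup ℚˣ}

theorem haarA_univ : haarA Γ Set.univ = 1 := by
  have := Measure.haarMeasure_self (K₀ := (⊤ : TopologicalSpace.PositiveCompacts (radAut Γ)))
  simpa [haarA] using this

instance haarA_isMulLeftInvariant : (haarA Γ).IsMulLeftInvariant := by
  unfold haarA
  infer_instance

instance haarA_isProbabilityMeasure : IsProbabilityMeasure (haarA Γ) := ⟨haarA_univ⟩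

open scoped Pointwise in
theorem haarA_smul (α : radAut Γ) (s : Set (radAut Γ)) : haarA Γ (α • s) = haarA Γ s :=
  measure_smul (haarA Γ) α s

/-- A subgroup with countably many left cosets (separated by the map `f`) has positive Haar measure. -/
theorem haarA_pos_of_countable {X : Type*} [Countable X] (H : Subgroup (radAut Γ))
    (f : radAut Γ → X) (hf : ∀ α β, f α = f β → α⁻¹ * β ∈ H) : 0 < haarA Γ H := by
  rw [pos_iff_ne_zero]
  intro h0
  have hnull : ∀ x, haarA Γ {α | f α = x} = 0 := by
    intro x
    rcases Set.eq_empty_or_nonempty {α | f α = x} with h | ⟨α, hα⟩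
    · rw [h, measure_empty]
    · open scoped Pointwise in
      refine measure_mono_null (t := α • (H : Set (radAut Γ))) (fun β hβ => ?_) ?_
      · rw [Set.mem_smul_set_iff_inv_smul_mem]
        exact hf α β (hα.trans hβ.symm)
      · rw [haarA_smul, h0]
  have huniv : (Set.univ : Set (radAut Γ)) = ⋃ x, {α | f α = x} := by
    ext α
    simp
  have := haarA_univ (Γ := Γ)
  rw [huniv, measure_iUnion_null hnull] at this
  exact zero_ne_one this

instance radicalGroup_countable : Countable (radicalGroup Γ) := by
  have : Countable {x : radicalField Γ | IsAlgebraic ℚ x} :=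
    (Algebraic.countable ℚ (radicalField Γ)).to_subtype
  refine Function.Injective.countable (f := fun x : radicalGroup Γ =>
    (⟨toField x, Algebra.IsAlgebraic.isAlgebraic _⟩ : {x : radicalField Γ | IsAlgebraic ℚ x})) ?_
  intro x y h
  exact toField_injective (congrArg Subtype.val h)

theorem exists_pow_of_isPrimitiveRoot {N : ℕ} (hN : 1 ≤ N) {ζ z : radicalGroup Γ}
    (hζ : IsPrimitiveRoot ζ N) (hz : z ^ N = 1) : ∃ i < N, ζ ^ i = z := by
  have : NeZero N := ⟨by omega⟩
  obtain ⟨i, hi, h⟩ := (hζ.map_of_injective (f := toFieldHom Γ)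
    toField_injective).eq_pow_of_pow_eq_one (ξ := toField z) (by
      rw [← toField_pow, hz, toField_one])
  exact ⟨i, hi, toField_injective (by rw [toField_pow]; exact h)⟩

theorem act_isOfFinOrder (α : radAut Γ) {z : radicalGroup Γ} (hz : IsOfFinOrder z) :
    IsOfFinOrder (act α z) :=
  MonoidHom.isOfFinOrder (α.1 : radicalGroup Γ →* radicalGroup Γ) hz

/-- On roots of unity every element of `A` agrees with a Galois automorphism: this holds for roots of
unity of bounded order, and the Galois group is compact. -/
theorem exists_galRestrict_eq_on_rootsOfUnity (α : radAut Γ) :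
    ∃ g ∈ (galRestrict Γ).range, ∀ z, IsOfFinOrder z → act g z = act α z := by
  let C : ℕ → Set (radAut Γ) := fun k => {g | g ∈ (galRestrict Γ).range ∧
    ∀ z : radicalGroup Γ, z ^ k.factorial = 1 → act g z = act α z}
  have hclosed : ∀ k, IsClosed (C k) := by
    intro k
    have : C k = ((galRestrict Γ).range : Set (radAut Γ)) ∩
        ⋂ z : radicalGroup Γ, ⋂ _ : z ^ k.factorial = 1, {g | act g z = act α z} := by
      ext g
      simp [C]
    rw [this]
    exact (isClosed_galRestrict_range Γ).inter
      (isClosed_iInter fun z => isClosed_iInter fun _ => isClosed_act_eq z _)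
  have hne : ∀ k, (C k).Nonempty := by
    intro k
    have hN := Nat.factorial_pos k
    obtain ⟨ζ, hζ⟩ := exists_isPrimitiveRoot Γ hN
    have hαζ : IsPrimitiveRoot (act α ζ) k.factorial :=
      hζ.map_of_injective (f := α.1) α.1.injective
    obtain ⟨u, -, hu⟩ := exists_pow_of_isPrimitiveRoot hN hζ hαζ.pow_eq_one
    have hcop : u.Coprime k.factorial := (hζ.pow_iff_coprime hN u).1 (hu ▸ hαζ)
    obtain ⟨σ, hσ⟩ := exists_galois_pow Γ hN hcop
    refine ⟨galRestrict Γ σ, ⟨σ, rfl⟩, fun z hz => ?_⟩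
    obtain ⟨i, -, rfl⟩ := exists_pow_of_isPrimitiveRoot hN hζ hz
    rw [act_map_pow, act_map_pow, hσ ζ hζ.pow_eq_one, hu]
  obtain ⟨g, hg⟩ := IsCompact.nonempty_iInter_of_sequence_nonempty_isCompact_isClosed C
    (fun k => by
      rintro g ⟨h1, h2⟩
      refine ⟨h1, fun z hz => h2 z ?_⟩
      rw [Nat.factorial_succ, mul_comm, pow_mul, hz, one_pow])
    hne (hclosed 0).isCompact hclosed
  rw [Set.mem_iInter] at hg
  refine ⟨g, (hg 0).1, fun z hz => ?_⟩
  obtain ⟨m, hm, h⟩ := isOfFinOrder_iff_pow_eq_one.1 hz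
  refine (hg m).2 z ?_
  obtain ⟨c, hc⟩ := Nat.dvd_factorial hm le_rfl
  rw [hc, pow_mul, h, one_pow]

/-- The elements of the Galois group that fix the elements of a set `E`. -/
def galoisFixing (Γ : Subgroup ℚˣ) (E : Set (radicalGroup Γ)) : Subgroup (radAut Γ) where
  carrier := {α | α ∈ (galRestrict Γ).range ∧ ∀ x ∈ E, act α x = x}
  one_mem' := ⟨one_mem _, fun _ _ => rfl⟩
  mul_mem' := by
    rintro α β ⟨h1, h2⟩ ⟨h3, h4⟩
    exact ⟨mul_mem h1 h3, fun x hx => by rw [act_mul, h4 x hx, h2 x hx]⟩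
  inv_mem' := by
    rintro α ⟨h1, h2⟩
    exact ⟨inv_mem h1, fun x hx => act_inv_eq_iff.2 (h2 x hx).symm⟩

theorem mem_galoisFixing {E : Set (radicalGroup Γ)} {α : radAut Γ} :
    α ∈ galoisFixing Γ E ↔ α ∈ (galRestrict Γ).range ∧ ∀ x ∈ E, act α x = x := Iff.rfl

theorem isClosed_galoisFixing (E : Set (radicalGroup Γ)) :
    IsClosed (galoisFixing Γ E : Set (radAut Γ)) := by
  have : (galoisFixing Γ E : Set (radAut Γ)) = ((galRestrict Γ).range : Set (radAut Γ)) ∩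
      ⋂ x ∈ E, {g | act g x = x} := by
    ext g
    simp [mem_galoisFixing]
  rw [this]
  exact (isClosed_galRestrict_range Γ).inter
    (isClosed_iInter fun z => isClosed_iInter fun _ => isClosed_act_eq z _)

/-- Modulo `ℚ*` there are finitely many square roots of rational numbers in `Γ_∞`. -/
theorem exists_finite_sqrt_reps {n : ℕ} (a : Fin n → ℚˣ) :
    ∃ R : Set (radicalGroup (genGroup a)), R.Finite ∧
      (∀ y : radicalGroup (genGroup a), ((y ^ 2 : radicalGroup _) : ℂˣ) ∈ ratUnits.range →
        ∃ r ∈ R, ((y * r : radicalGroup _) : ℂˣ) ∈ ratUnits.range) := by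
  obtain ⟨D, hD⟩ := finite_square_classes a
  let Q : ℚˣ → Prop := fun d => ∃ y : radicalGroup (genGroup a), ∃ t : ℚˣ,
    (y : ℂˣ) ^ 2 = ratUnits (d * t ^ 2)
  let r : ℚˣ → radicalGroup (genGroup a) := fun d => open Classical in
    if h : Q d then h.choose else 1
  have hr : ∀ d, Q d → ∃ t : ℚˣ, (r d : ℂˣ) ^ 2 = ratUnits (d * t ^ 2) := by
    intro d h
    simp only [r, dif_pos h]
    exact h.choose_spec
  refine ⟨r '' D, D.finite_toSet.image r, ?_⟩
  rintro y ⟨q, hq⟩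
  have hy2 : (y : ℂˣ) ^ 2 = ratUnits q := by simpa using hq.symm
  obtain ⟨m, hm, γ, hγ, hy⟩ := exists_pow_eq_ratUnits y
  obtain ⟨d, hdD, t, rfl⟩ := hD q m hm (by
    have : q ^ m = γ ^ 2 := by
      apply ratUnits_injective
      rw [map_pow, map_pow, ← hy, ← hy2, ← pow_mul, ← pow_mul, mul_comm]
    rw [this]
    exact pow_mem hγ 2)
  obtain ⟨s, hs⟩ := hr d ⟨y, t, hy2⟩
  refine ⟨r d, ⟨d, hdD, rfl⟩, ?_⟩
  have h2 : ((y : ℂˣ) * (r d : ℂˣ)) ^ 2 = (ratUnits (d * t * s)) ^ 2 := by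
    rw [mul_pow, hy2, hs, ← map_mul, ← map_pow]
    congr 1
    rw [mul_pow, mul_pow, mul_mul_mul_comm, ← sq, mul_assoc]
  have h3 := congrArg Units.val h2
  push_cast at h3
  rcases sq_eq_sq_iff_eq_or_eq_neg.1 h3 with h | h
  · exact ⟨d * t * s, Units.ext h.symm⟩
  · refine ⟨-(d * t * s), Units.ext ?_⟩
    change _ = ((y : ℂˣ) : ℂ) * ((r d : ℂˣ) : ℂ)
    rw [h]
    simp [ratUnits_coe]

/-- The subgroup of the Galois group fixing finitely many elements has positive measure. An element
`α` of `A` is the product of an element that is trivial on roots of unity and a Galois automorphism;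
its coset is determined by its action on the given elements and by the action of
the first factor on representatives of the square roots of rationals. -/
theorem haarA_galoisFixing_pos {n : ℕ} (a : Fin n → ℚˣ) {E : Set (radicalGroup (genGroup a))}
    (hE : E.Finite) : 0 < haarA (genGroup a) (galoisFixing (genGroup a) E) := by
  obtain ⟨R, hRfin, hR⟩ := exists_finite_sqrt_reps a
  have := hE.to_subtype
  have := hRfin.to_subtype
  choose g hg hgα using exists_galRestrict_eq_on_rootsOfUnity (Γ := genGroup a)
  refine haarA_pos_of_countable (X := (E → radicalGroup (genGroup a)) ×
    (R → radicalGroup (genGroup a))) _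
    (fun α => (fun x => act α x, fun x => act (α * (g α)⁻¹) x)) ?_
  intro α β h
  have hE' : ∀ x ∈ E, act α x = act β x := fun x hx => congrFun (congrArg Prod.fst h) ⟨x, hx⟩
  have hR' : ∀ x ∈ R, act (α * (g α)⁻¹) x = act (β * (g β)⁻¹) x := fun x hx =>
    congrFun (congrArg Prod.snd h) ⟨x, hx⟩
  have htors : ∀ (α : radAut (genGroup a)) z, IsOfFinOrder z → act (α * (g α)⁻¹) z = z := by
    intro α z hz
    have h1 : act (g α) (act (g α)⁻¹ z) = z := by rw [← act_mul, mul_inv_cancel, act_one]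
    rw [act_mul, ← hgα α _ (act_isOfFinOrder _ hz), h1]
  refine ⟨?_, fun x hx => ?_⟩
  · have hmem : (α * (g α)⁻¹)⁻¹ * (β * (g β)⁻¹) ∈ (galRestrict (genGroup a)).range := by
      refine mem_galRestrict_range_of_trivial (fun z hz => ?_) (fun y hy => ?_)
      · rw [act_mul, htors β z hz, act_inv_eq_iff, htors α z hz]
      · obtain ⟨r, hr, hyr⟩ := hR y hy
        have h1 : act ((α * (g α)⁻¹)⁻¹ * (β * (g β)⁻¹)) r = r := by
          rw [act_mul, act_inv_eq_iff, hR' r hr]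
        have h2 := ((α * (g α)⁻¹)⁻¹ * (β * (g β)⁻¹)).2 _ hyr
        change act _ _ = _ at h2
        rw [act_map_mul, h1] at h2
        exact mul_right_cancel h2
    have : α⁻¹ * β = (g α)⁻¹ * ((α * (g α)⁻¹)⁻¹ * (β * (g β)⁻¹)) * g β := by group
    rw [this]
    exact mul_mem (mul_mem (inv_mem (hg α)) hmem) (hg β)
  · rw [act_mul, act_inv_eq_iff, hE' x hx]

end Haar

/-! ### Galois automorphisms with prescribed actions on radicals -/

section Constructions

variable {Γ : Subgroup ℚˣ}

theorem exists_root {γ : ℚˣ} (hγ : γ ∈ Γ) {k : ℕ} (hk : 1 ≤ k) :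
    ∃ x : radicalGroup Γ, (x : ℂˣ) ^ k = ratUnits γ := by
  obtain ⟨y, hy⟩ := IsAlgClosed.exists_pow_nat_eq ((ratUnits γ : ℂˣ) : ℂ) hk
  have hy0 : y ≠ 0 := by
    rintro rfl
    rw [zero_pow (by omega)] at hy
    exact (ratUnits γ).ne_zero hy.symm
  have h : Units.mk0 y hy0 ^ k = ratUnits γ := Units.ext hy
  exact ⟨⟨_, mem_radicalGroup_of_pow hk hγ h⟩, h⟩

theorem act_eq_self_of_mem_range (α : radAut Γ) {x : radicalGroup Γ}
    (hx : (x : ℂˣ) ∈ ratUnits.range) : act α x = x := α.2 x hx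

/-- If `α` fixes the `k`-th roots of unity then `α ^ k` fixes the `k`-th roots of rationals. -/
theorem act_pow_eq_self {α : radAut Γ} {k : ℕ} (hα : ∀ z : radicalGroup Γ, z ^ k = 1 → act α z = z)
    {x : radicalGroup Γ} (hx : ((x ^ k : radicalGroup Γ) : ℂˣ) ∈ ratUnits.range) :
    act (α ^ k) x = x := by
  have hε : (act α x / x) ^ k = 1 := by
    rw [div_pow, div_eq_one, ← act_map_pow]
    exact act_eq_self_of_mem_range α hx
  have key : ∀ l : ℕ, act (α ^ l) x = x * (act α x / x) ^ l := by
    intro l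
    induction l with
    | zero => simp [act_one]
    | succ l ih =>
      rw [pow_succ', act_mul, ih, act_map_mul, act_map_pow, hα _ hε, pow_succ']
      rw [← mul_assoc, mul_div_cancel]
  rw [key, hε, mul_one]

/-- Prescribing the Galois action on roots of unity of two coprime orders. -/
theorem exists_galois_crt (Γ : Subgroup ℚˣ) {N p u : ℕ} (hN : 1 ≤ N) (hp : 1 ≤ p)
    (hNp : N.Coprime p) (hu : u.Coprime p) : ∃ g ∈ (galRestrict Γ).range,
      (∀ z : radicalGroup Γ, z ^ N = 1 → act g z = z) ∧
      ∀ z : radicalGroup Γ, z ^ p = 1 → act g z = z ^ u := by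
  obtain ⟨v, hvN, hvp⟩ := Nat.chineseRemainder hNp 1 u
  have hcop : v.Coprime (N * p) := by
    refine Nat.Coprime.mul_right ?_ ?_
    · have := hvN.gcd_eq
      rwa [Nat.gcd_one_left] at this
    · have := hvp.gcd_eq
      rwa [show u.gcd p = 1 from hu] at this
  obtain ⟨σ, hσ⟩ := exists_galois_pow Γ (Nat.mul_pos hN hp) hcop
  have hmod : ∀ {z : radicalGroup Γ} {k s t : ℕ}, z ^ k = 1 → s ≡ t [MOD k] → z ^ s = z ^ t :=
    fun {z k s t} hz h => pow_eq_pow_iff_modEq.2 (h.of_dvd (orderOf_dvd_of_pow_eq_one hz))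
  refine ⟨galRestrict Γ σ, ⟨σ, rfl⟩, fun z hz => ?_, fun z hz => ?_⟩
  · rw [hσ z (by rw [pow_mul, hz, one_pow]), hmod hz hvN, pow_one]
  · rw [hσ z (by rw [mul_comm, pow_mul, hz, one_pow]), hmod hz hvp]

/-- A Galois automorphism can be changed, without changing its action on square roots of
rationals and on cube roots of unity, into one that moves `p`-th roots of unity for given primes
`p ≥ 5`: one multiplies by squares, and there are nontrivial squares modulo `p`. -/
theorem exists_galois_moving_rootsOfUnity {g : radAut Γ} (hg : g ∈ (galRestrict Γ).range)
    (S : Finset ℕ) (hS : ∀ p ∈ S, p.Prime ∧ 5 ≤ p) : ∃ g' ∈ (galRestrict Γ).range,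
      (∀ x : radicalGroup Γ, ((x ^ 2 : radicalGroup Γ) : ℂˣ) ∈ ratUnits.range →
        act g' x = act g x) ∧
      (∀ z : radicalGroup Γ, z ^ 3 = 1 → act g' z = act g z) ∧
      ∀ p ∈ S, ∃ z : radicalGroup Γ, z ^ p = 1 ∧ act g' z ≠ z := by
  induction S using Finset.induction_on with
  | empty => exact ⟨g, hg, fun _ _ => rfl, fun _ _ => rfl, by simp⟩
  | insert p S hpS ih =>
    obtain ⟨g₁, hg₁, h2, h3, hmove⟩ := ih fun q hq => hS q (Finset.mem_insert_of_mem hq)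
    obtain ⟨hp, hp5⟩ := hS p (Finset.mem_insert_self p S)
    by_cases hpz : ∃ z : radicalGroup Γ, z ^ p = 1 ∧ act g₁ z ≠ z
    · refine ⟨g₁, hg₁, h2, h3, fun q hq => ?_⟩
      rcases Finset.mem_insert.1 hq with rfl | hq
      · exact hpz
      · exact hmove q hq
    · push Not at hpz
      have hcop : (6 * ∏ q ∈ S, q).Coprime p := by
        refine Nat.Coprime.mul_left ?_ (Nat.Coprime.prod_left fun q hq => ?_)
        · refine ((Nat.Prime.coprime_iff_not_dvd hp).2 fun h => ?_).symm
          have := (Nat.Prime.dvd_mul hp).1 (show p ∣ 2 * 3 from h)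
          rcases this with h | h
          · exact absurd (Nat.le_of_dvd (by omega) h) (by omega)
          · exact absurd (Nat.le_of_dvd (by omega) h) (by omega)
        · refine (Nat.coprime_primes (hS q (Finset.mem_insert_of_mem hq)).1 hp).2 ?_
          rintro rfl
          exact hpS hq
      have hpos : 1 ≤ 6 * ∏ q ∈ S, q := Nat.mul_pos (by omega) (Finset.prod_pos fun q hq =>
        (hS q (Finset.mem_insert_of_mem hq)).1.pos)
      have hcop2 : Nat.Coprime 2 p := (Nat.coprime_primes Nat.prime_two hp).2 (by omega)
      obtain ⟨ρ, hρ, hρ1, hρ2⟩ := exists_galois_crt Γ hpos hp.one_le hcop hcop2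
      have hdvd : ∀ {k : ℕ}, k ∣ 6 * ∏ q ∈ S, q → ∀ z : radicalGroup Γ, z ^ k = 1 →
          act ρ z = z := by
        rintro k ⟨c, hc⟩ z hz
        exact hρ1 z (by rw [hc, pow_mul, hz, one_pow])
      have hρρ : ∀ {z : radicalGroup Γ}, act ρ z = z → act (g₁ * ρ ^ 2) z = act g₁ z := by
        intro z hz
        rw [act_mul, sq, act_mul, hz, hz]
      refine ⟨g₁ * ρ ^ 2, mul_mem hg₁ (pow_mem hρ 2), fun x hx => ?_, fun z hz => ?_,
        fun q hq => ?_⟩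
      · rw [act_mul, act_pow_eq_self (hdvd (Dvd.dvd.mul_right (by norm_num) _)) hx, h2 x hx]
      · rw [hρρ (hdvd (Dvd.dvd.mul_right (by norm_num) _) z hz), h3 z hz]
      · rcases Finset.mem_insert.1 hq with rfl | hq
        · obtain ⟨ζ, hζ⟩ := exists_isPrimitiveRoot Γ hp.one_le
          refine ⟨ζ, hζ.pow_eq_one, ?_⟩
          rw [act_mul, sq, act_mul, hρ2 ζ hζ.pow_eq_one, act_map_pow, hρ2 ζ hζ.pow_eq_one,
            ← pow_mul, act_map_pow, hpz ζ hζ.pow_eq_one]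
          intro h
          have := hζ.pow_inj (i := 4) (j := 1) (by omega) (by omega) (by rw [pow_one]; exact h)
          omega
        · obtain ⟨z, hz, hz'⟩ := hmove q hq
          refine ⟨z, hz, ?_⟩
          rwa [hρρ (hdvd (Dvd.dvd.mul_left (Finset.dvd_prod_of_mem _ hq) _) z hz)]

/-- A Galois automorphism that is trivial on cube roots of unity can be changed, without changing
its action on roots of unity and on square roots of rationals, into one that acts on the cube roots
of `Γ` through any given character. -/
theorem exists_galois_cubic_character {g : radAut Γ} (hg : g ∈ (galRestrict Γ).range)
    (hg3 : ∀ z : radicalGroup Γ, z ^ 3 = 1 → act g z = z)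
    (χ : barGroup Γ 3 →* rootsOfUnity 3 ℂ) : ∃ g' ∈ (galRestrict Γ).range,
      (∀ x : radicalGroup Γ, ((x ^ 2 : radicalGroup Γ) : ℂˣ) ∈ ratUnits.range →
        act g' x = act g x) ∧
      (∀ z : radicalGroup Γ, IsOfFinOrder z → act g' z = act g z) ∧
      ∀ (x : radicalGroup Γ) (γ : ℚˣ) (hγ : γ ∈ Γ), (x : ℂˣ) ^ 3 = ratUnits γ →
        ((act g' x : radicalGroup Γ) : ℂˣ) = x * χ ⟨classMap 3 γ, γ, hγ, rfl⟩ := by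
  have hle : rootsOfUnity 3 ℂ ≤ radicalGroup Γ := fun z hz =>
    mem_radicalGroup_of_pow_eq_one (m := 3) (by norm_num) ((mem_rootsOfUnity 3 z).1 hz)
  have hle' : rootGroup Γ 3 ≤ radicalGroup Γ := rootGroup_le le_rfl (by norm_num)
  let cl : Γ →* barGroup Γ 3 := (classMap 3).subgroupMap Γ
  let θ : rootGroup Γ 3 →* radicalGroup Γ := (Subgroup.inclusion hle).comp
    (χ.comp (cl.comp (rootPow Γ 3)))
  let β : rootGroup Γ 3 →* radicalGroup Γ :=
    ((g⁻¹).1 : radicalGroup Γ →* radicalGroup Γ).comp (Subgroup.inclusion hle' * θ)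
  have hβ : ∀ x, β x = act g⁻¹ (Subgroup.inclusion hle' x * θ x) := fun _ => rfl
  have hθ : ∀ x, θ x ^ 3 = 1 := fun x => Subtype.ext
    ((mem_rootsOfUnity 3 _).1 (χ (cl (rootPow Γ 3 x))).2)
  obtain ⟨σ, h1, h2⟩ := exists_galois_of_rootGroupHom (Γ' := Γ) le_rfl (p := 3) (by decide) β (by
    intro x b hx
    have hpow : (rootPow Γ 3 x : ℚˣ) = b ^ 3 :=
      ratUnits_injective ((ratUnits_rootPow x).trans hx)
    have hcl : cl (rootPow Γ 3 x) = 1 := by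
      refine Subtype.ext ?_
      change classMap 3 (rootPow Γ 3 x : ℚˣ) = 1
      rw [hpow]
      exact (QuotientGroup.eq_one_iff _).2 ⟨_, rfl⟩
    have hθ1 : θ x = 1 := by
      change Subgroup.inclusion hle (χ (cl (rootPow Γ 3 x))) = 1
      rw [hcl, map_one, map_one]
    have hb : ratUnits b ∈ radicalGroup Γ :=
      mem_radicalGroup_of_pow (m := 3) (by norm_num) (rootPow Γ 3 x).2 (by rw [hpow, map_pow])
    have hx' : Subgroup.inclusion hle' x = (Subgroup.inclusion hle' x / ⟨_, hb⟩) * ⟨_, hb⟩ := by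
      rw [div_mul_cancel]
    have hz : (Subgroup.inclusion hle' x / ⟨_, hb⟩ : radicalGroup Γ) ^ 3 = 1 := by
      rw [div_pow, div_eq_one]
      refine Subtype.ext ?_
      change (x : ℂˣ) ^ 3 = ratUnits b ^ 3
      rw [hx, map_pow]
    have : β x = Subgroup.inclusion hle' x := by
      rw [hβ, hθ1, mul_one, act_inv_eq_iff]
      nth_rewrite 2 [hx']
      rw [act_map_mul, hg3 _ hz, act_eq_self_of_mem_range g (x := ⟨_, hb⟩) ⟨b, rfl⟩, ← hx']
    rw [this]
    rfl)
  -- The fourth power has the same effect on cube roots, and is trivial on square roots.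
  let τ := galRestrict Γ σ
  have hτ : τ ∈ (galRestrict Γ).range := ⟨σ, rfl⟩
  refine ⟨g * τ ^ 4, mul_mem hg (pow_mem hτ 4), fun x hx => ?_, fun z hz => ?_,
    fun x γ hγ hx => ?_⟩
  · have : act (τ ^ 2) x = x := act_pow_eq_self
      (fun z hz => h1 z (isOfFinOrder_iff_pow_eq_one.2 ⟨2, by norm_num, hz⟩)) hx
    rw [act_mul, show 4 = 2 + 2 from rfl, pow_add, act_mul, this, this]
  · have : act τ z = z := h1 z hz
    have h4 : τ ^ 4 = τ * τ * τ * τ := by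
      simp only [pow_succ, pow_zero, one_mul]
    rw [act_mul, h4]
    simp only [act_mul, this]
  · have hxm : (x : ℂˣ) ∈ rootGroup Γ 3 := ⟨γ, hγ, hx.symm⟩
    have h3 : act (τ ^ 3) x = x := act_pow_eq_self
      (fun z hz => h1 z (isOfFinOrder_iff_pow_eq_one.2 ⟨3, by norm_num, hz⟩))
      ⟨γ, by simpa using hx.symm⟩
    have hγ' : rootPow Γ 3 ⟨x, hxm⟩ = ⟨γ, hγ⟩ :=
      Subtype.ext (ratUnits_injective ((ratUnits_rootPow _).trans hx))
    rw [act_mul, show 4 = 1 + 3 from rfl, pow_add, act_mul, h3, pow_one, h2 x hxm, hβ,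
      ← act_mul, mul_inv_cancel, act_one]
    change (x : ℂˣ) * (χ (cl (rootPow Γ 3 ⟨x, hxm⟩)) : ℂˣ) = _
    rw [hγ']
    rfl

end Constructions

/-! ### The local conditions at finitely many primes -/

section Generators

variable {n : ℕ} {a : Fin n → ℚˣ}

theorem mem_genGroup (a : Fin n → ℚˣ) (i : Fin n) : a i ∈ genGroup a :=
  Subgroup.subset_closure ⟨i, rfl⟩

theorem w2_genClass (h : NoOddSquare a) (i : Fin n) : w2 a h (genClass a 2 i) = -1 :=
  (existsUnique_w2 a h).choose_spec.1 i

/-- The number `-3` as a unit. -/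
def negThree : ℚˣ := Units.mk0 (-3) (by norm_num)

theorem condA_iff (h : NoOddSquare a) : CondA a h ↔
    ∃ y : barGroup (genGroup a) 2, w2 a h y = 1 ∧ classMap 2 negThree = y := by
  constructor
  · rintro ⟨y, hy, h⟩
    exact ⟨y, hy, h.symm⟩
  · rintro ⟨y, hy, h⟩
    exact ⟨y, hy, h.symm⟩

/-- If condition (a) fails, `-3` can be added to the numbers `a_i`. -/
theorem noOddSquare_cons (h : NoOddSquare a) (hA : ¬ CondA a h) :
    NoOddSquare (Fin.cons negThree a : Fin (n + 1) → ℚˣ) := by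
  classical
  intro I hI hsq
  let I' : Finset (Fin n) := Finset.univ.filter fun i => i.succ ∈ I
  have hprod : ∏ i ∈ I, (Fin.cons negThree a : Fin (n + 1) → ℚˣ) i =
      (if (0 : Fin (n + 1)) ∈ I then negThree else 1) * ∏ i ∈ I', a i := by
    have := Finset.prod_ite_mem Finset.univ I (Fin.cons negThree a : Fin (n + 1) → ℚˣ)
    rw [Finset.univ_inter] at this
    rw [← this, Fin.prod_univ_succ, Finset.prod_filter]
    simp
  have hcard : I.card = (if (0 : Fin (n + 1)) ∈ I then 1 else 0) + I'.card := by
    have := Finset.sum_ite_mem Finset.univ I (fun _ => 1)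
    rw [Finset.univ_inter] at this
    rw [Finset.card_eq_sum_ones, ← this, Fin.sum_univ_succ, Finset.card_filter]
  by_cases h0 : (0 : Fin (n + 1)) ∈ I
  · rw [if_pos h0] at hprod hcard
    refine hA ((condA_iff h).2 ⟨∏ i ∈ I', genClass a 2 i, ?_, ?_⟩)
    · rw [map_prod, Finset.prod_congr rfl fun i _ => w2_genClass h i, Finset.prod_const]
      refine Even.neg_one_pow ?_
      rw [hcard] at hI
      rcases Nat.even_or_odd I'.card with h | h
      · exact h
      · exact absurd (Odd.add_odd odd_one h) (Nat.not_even_iff_odd.2 hI)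
    · obtain ⟨s, hs⟩ := hsq
      rw [hprod] at hs
      have h1 : classMap 2 negThree * classMap 2 (∏ i ∈ I', a i) = 1 := by
        rw [← map_mul, hs]
        exact (QuotientGroup.eq_one_iff _).2 ⟨s, sq s⟩
      have h2 : ((∏ i ∈ I', genClass a 2 i : barGroup (genGroup a) 2) :
          ℚˣ ⧸ (powMonoidHom 2 : ℚˣ →* ℚˣ).range) = classMap 2 (∏ i ∈ I', a i) := by
        rw [map_prod, Subgroup.val_finsetProd]
        rfl
      have h3 := barGroup_pow (genGroup a) 2 (∏ i ∈ I', genClass a 2 i)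
      have h4 := congrArg Subtype.val h3
      rw [Subgroup.coe_pow, h2, sq] at h4
      rw [h2]
      exact mul_right_cancel (h1.trans h4.symm)
  · rw [if_neg h0] at hprod hcard
    rw [one_mul] at hprod
    rw [zero_add] at hcard
    exact h I' (hcard ▸ hI) (hprod ▸ hsq)

/-- `2 ω + 1` is a square root of `-3` in `ℚ(Γ_∞)` for a primitive cube root of unity `ω`. -/
theorem sq_two_mul_add_one_eq {Γ : Subgroup ℚˣ} {ω : radicalGroup Γ} (hω : IsPrimitiveRoot ω 3) :
    (2 * toField ω + 1) ^ 2 = algebraMap ℚ (radicalField Γ) (negThree : ℚ) := by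
  have h : IsPrimitiveRoot (toField ω) 3 :=
    hω.map_of_injective (f := toFieldHom Γ) toField_injective
  have h1 : toField ω ≠ 1 := h.ne_one (by norm_num)
  have h3 := h.pow_eq_one
  have h4 : (toField ω - 1) * (toField ω ^ 2 + toField ω + 1) = 0 := by linear_combination h3
  have h5 := (mul_eq_zero.1 h4).resolve_left (sub_ne_zero.2 h1)
  simp only [negThree, Units.val_mk0, map_neg, map_ofNat]
  linear_combination 4 * h5

/-- If condition (a) or condition (b) fails, there is a Galois automorphism satisfying the local
conditions at any finite number of primes. -/
theorem exists_galois_locally_good (h : NoOddSquare a) (hAB : ¬ (CondA a h ∧ CondB a)) (P : ℕ) :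
    ∃ g ∈ (galRestrict (genGroup a)).range,
      (∀ (i : Fin n) (x : radicalGroup (genGroup a)), (x : ℂˣ) ^ 2 = ratUnits (a i) →
        act g x ≠ x) ∧
      (∀ i : Fin n, (∃ z : radicalGroup (genGroup a), z ^ 3 = 1 ∧ act g z ≠ z) ∨
        ∀ x : radicalGroup (genGroup a), (x : ℂˣ) ^ 3 = ratUnits (a i) → act g x ≠ x) ∧
      ∀ p : ℕ, p.Prime → 5 ≤ p → p ≤ P →
        ∃ z : radicalGroup (genGroup a), z ^ p = 1 ∧ act g z ≠ z := by
  set Γ := genGroup a with hΓ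
  let S : Finset ℕ := (Finset.range (P + 1)).filter fun p => p.Prime ∧ 5 ≤ p
  have hS : ∀ p ∈ S, p.Prime ∧ 5 ≤ p := fun p hp => (Finset.mem_filter.1 hp).2
  have hmemS : ∀ p : ℕ, p.Prime → 5 ≤ p → p ≤ P → p ∈ S := fun p h1 h2 h3 =>
    Finset.mem_filter.2 ⟨Finset.mem_range.2 (by omega), h1, h2⟩
  have hsqrt : ∀ {σ : radicalField Γ ≃ₐ[ℚ] radicalField Γ} {i : Fin n},
      (∀ y : radicalField Γ, y ^ 2 = algebraMap ℚ _ (a i : ℚ) → σ y = -y) →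
      ∀ x : radicalGroup Γ, (x : ℂˣ) ^ 2 = ratUnits (a i) → act (galRestrict Γ σ) x ≠ x := by
    intro σ i hσ x hx hfix
    have h1 := hσ (toField x) (by
      rw [← toField_pow]
      exact toField_eq_algebraMap_iff.2 (by simpa using hx))
    rw [← toField_act_galRestrict, hfix] at h1
    exact toField_ne_zero x (self_eq_neg.1 h1)
  have hrat : ∀ {i : Fin n} {x : radicalGroup Γ}, (x : ℂˣ) ^ 2 = ratUnits (a i) →
      ((x ^ 2 : radicalGroup Γ) : ℂˣ) ∈ ratUnits.range := fun {i x} hx => ⟨a i, by simpa using hx.symm⟩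
  by_cases hA : CondA a h
  · have hB : ¬ CondB a := fun hB => hAB ⟨hA, hB⟩
    obtain ⟨σ, hσ⟩ := exists_galois_neg_sqrt Γ h
    obtain ⟨g, hg, h2, -, hmove⟩ := exists_galois_moving_rootsOfUnity (Γ := Γ) ⟨σ, rfl⟩ S hS
    have hg2 : ∀ (i : Fin n) (x : radicalGroup Γ), (x : ℂˣ) ^ 2 = ratUnits (a i) → act g x ≠ x := by
      intro i x hx
      rw [h2 x (hrat hx)]
      exact hsqrt (hσ i) x hx
    by_cases h3 : ∃ z : radicalGroup Γ, z ^ 3 = 1 ∧ act g z ≠ z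
    · exact ⟨g, hg, hg2, fun i => Or.inl h3, fun p h1 h2 h3 => hmove p (hmemS p h1 h2 h3)⟩
    · push Not at h3
      unfold CondB at hB
      push Not at hB
      obtain ⟨χ, hχ⟩ := hB
      obtain ⟨g', hg', h2', htors, hcub⟩ := exists_galois_cubic_character hg h3 χ
      refine ⟨g', hg', fun i x hx => ?_, fun i => Or.inr fun x hx hfix => ?_, fun p h1 h2 h3 => ?_⟩
      · rw [h2' x (hrat hx)]
        exact hg2 i x hx
      · have := hcub x (a i) (mem_genGroup a i) hx
        rw [hfix] at this
        have h1 : (χ (genClass a 3 i) : ℂˣ) = 1 := left_eq_mul.1 this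
        exact hχ i (Subtype.ext h1)
      · obtain ⟨z, hz, hz'⟩ := hmove p (hmemS p h1 h2 h3)
        exact ⟨z, hz, by
          rwa [htors z (isOfFinOrder_iff_pow_eq_one.2 ⟨p, h1.pos, hz⟩)]⟩
  · obtain ⟨σ, hσ⟩ := exists_galois_neg_sqrt Γ (noOddSquare_cons h hA)
    have hσa : ∀ (i : Fin n) (y : radicalField Γ), y ^ 2 = algebraMap ℚ _ (a i : ℚ) → σ y = -y :=
      fun i y hy => hσ i.succ y (by simpa using hy)
    obtain ⟨g, hg, h2, h3, hmove⟩ := exists_galois_moving_rootsOfUnity (Γ := Γ) ⟨σ, rfl⟩ S hS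
    refine ⟨g, hg, fun i x hx => ?_, fun i => Or.inl ?_,
      fun p h1 h2 h3 => hmove p (hmemS p h1 h2 h3)⟩
    · rw [h2 x (hrat hx)]
      exact hsqrt (hσa i) x hx
    · obtain ⟨ω, hω⟩ := exists_isPrimitiveRoot Γ (m := 3) (by norm_num)
      refine ⟨ω, hω.pow_eq_one, ?_⟩
      rw [h3 ω hω.pow_eq_one]
      intro hfix
      have hs := sq_two_mul_add_one_eq hω
      have h4 := hσ 0 (2 * toField ω + 1) (by simpa using hs)
      have h5 : σ (toField ω) = toField ω := by rw [← toField_act_galRestrict, hfix]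
      rw [map_add, map_mul, h5, map_one, map_ofNat] at h4
      have h6 := self_eq_neg.1 h4
      rw [h6] at hs
      simp [negThree] at hs

end Generators

/-! ### Bounding measures by counting cosets -/

section IndexBound

variable {Γ : Subgroup ℚˣ}

open scoped Pointwise in
/-- Elements of `H` in distinct cosets of a smaller closed subgroup `D` bound the measure
of `D`. -/
theorem card_mul_haarA_le {J : Type*} [Fintype J] {D H : Subgroup (radAut Γ)} (hDH : D ≤ H)
    (hD : IsClosed (D : Set (radAut Γ))) (f : J → radAut Γ) (hf : ∀ j, f j ∈ H)
    (hinj : ∀ j k, (f j)⁻¹ * f k ∈ D → j = k) :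
    (Fintype.card J : ENNReal) * haarA Γ D ≤ haarA Γ H := by
  have hdisj : Pairwise (Function.onFun Disjoint fun j => f j • (D : Set (radAut Γ))) := by
    intro j k hjk
    rw [Function.onFun, Set.disjoint_left]
    intro x hx hx'
    rw [Set.mem_smul_set_iff_inv_smul_mem] at hx hx'
    refine hjk (hinj j k ?_)
    have := mul_mem hx (inv_mem hx')
    have he : (f j)⁻¹ • x * ((f k)⁻¹ • x)⁻¹ = (f j)⁻¹ * f k := by
      simp only [smul_eq_mul]
      group
    rwa [he] at this
  have hmeas : ∀ j, MeasurableSet (f j • (D : Set (radAut Γ))) := fun j =>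
    (hD.leftCoset (f j)).measurableSet
  have hsub : (⋃ j, f j • (D : Set (radAut Γ))) ⊆ H := by
    refine Set.iUnion_subset fun j x hx => ?_
    rw [Set.mem_smul_set_iff_inv_smul_mem] at hx
    have := mul_mem (hf j) (hDH hx)
    simpa using this
  calc (Fintype.card J : ENNReal) * haarA Γ D = ∑ j, haarA Γ (f j • (D : Set (radAut Γ))) := by
        simp
    _ = haarA Γ (⋃ j, f j • (D : Set (radAut Γ))) := by
        rw [measure_iUnion hdisj hmeas, tsum_fintype]
    _ ≤ haarA Γ H := measure_mono hsub

/-- There are at least `(p - 1) / 6` sixth powers of units modulo `p`. -/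
theorem le_six_mul_card_sixth_powers (p : ℕ) [Fact p.Prime] :
    p - 1 ≤ 6 * Nat.card (powMonoidHom 6 : (ZMod p)ˣ →* (ZMod p)ˣ).range := by
  have h1 := Subgroup.card_mul_index (powMonoidHom 6 : (ZMod p)ˣ →* (ZMod p)ˣ).ker
  rw [Subgroup.index_ker, Nat.card_eq_fintype_card (α := (ZMod p)ˣ), ZMod.card_units p] at h1
  have h2 : Nat.card (powMonoidHom 6 : (ZMod p)ˣ →* (ZMod p)ˣ).ker ≤ 6 := by
    have : Nat.card (rootsOfUnity 6 (ZMod p)) ≤ 6 := card_rootsOfUnity _ _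
    exact this
  rw [← h1]
  exact Nat.mul_le_mul_right _ h2

/-- For an odd prime `p` and a rational number `a ≠ ±1` that is not a `p`-th power there is a
Galois automorphism over `ℚ(μ_∞)` that multiplies the `p`-th roots of `a` by a given `p`-th root of
unity. -/
theorem exists_galois_mul_root {a : ℚˣ} (haΓ : a ∈ Γ) (h1 : a ≠ 1) (h2 : a ≠ -1) {p : ℕ}
    (hp : p.Prime) (hp2 : p ≠ 2) (hap : ¬ ∃ b : ℚˣ, a = b ^ p) {ζ : radicalGroup Γ}
    (hζ : ζ ^ p = 1) : ∃ g ∈ (galRestrict Γ).range,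
      (∀ z, IsOfFinOrder z → act g z = z) ∧
      ∀ x : radicalGroup Γ, (x : ℂˣ) ^ p = ratUnits a → act g x = x * ζ := by
  have hinf : Function.Injective fun k : ℤ => a ^ k := by
    rw [injective_zpow_iff_not_isOfFinOrder]
    intro hfin
    obtain ⟨P, hP⟩ := exists_forall_not_pow h1 h2
    obtain ⟨m, hm, h⟩ := isOfFinOrder_iff_pow_eq_one.1 hfin
    refine hP (m * P + 1) ?_ ⟨a, by rw [pow_succ, pow_mul, h, one_pow, one_mul]⟩
    nlinarith
  let e : Multiplicative ℤ ≃* Subgroup.zpowers a := MulEquiv.ofBijective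
    (zpowersHom (Subgroup.zpowers a) ⟨a, Subgroup.mem_zpowers a⟩) (by
      constructor
      · intro k l h
        have := congrArg Subtype.val h
        simp only [zpowersHom_apply, SubgroupClass.coe_zpow] at this
        exact Multiplicative.toAdd.injective (hinf this)
      · rintro ⟨_, k, rfl⟩
        exact ⟨Multiplicative.ofAdd k, Subtype.ext (by simp [zpowersHom_apply])⟩)
  have he : ∀ k : ℤ, (e (Multiplicative.ofAdd k) : ℚˣ) = a ^ k := fun k => by
    change ((zpowersHom (Subgroup.zpowers a) ⟨a, Subgroup.mem_zpowers a⟩)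
      (Multiplicative.ofAdd k) : ℚˣ) = a ^ k
    simp [zpowersHom_apply]
  let ψ : Subgroup.zpowers a →* radicalGroup Γ := (zpowersHom _ ζ).comp e.symm
  have hψ : ∀ k : ℤ, ψ (e (Multiplicative.ofAdd k)) = ζ ^ k := fun k => by
    simp [ψ, zpowersHom_apply]
  have hle : Subgroup.zpowers a ≤ Γ := (Subgroup.zpowers_le).2 haΓ
  have hle' : rootGroup (Subgroup.zpowers a) p ≤ radicalGroup Γ := rootGroup_le hle hp.one_le
  obtain ⟨σ, hσ1, hσ2⟩ := exists_galois_of_rootGroupHom hle (hp.odd_of_ne_two hp2)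
    (Subgroup.inclusion hle' * ψ.comp (rootPow (Subgroup.zpowers a) p)) (by
      intro x b hx
      obtain ⟨k, hk⟩ := e.surjective (rootPow _ p x)
      have hb : a ^ (k.toAdd) = b ^ p := by
        rw [← he]
        apply ratUnits_injective
        rw [← hx, ← ratUnits_rootPow]
        exact congrArg (fun t : Subgroup.zpowers a => ratUnits (t : ℚˣ)) hk
      have hpk : (p : ℤ) ∣ k.toAdd := by
        by_contra hnd
        have hcop : IsCoprime k.toAdd (p : ℤ) :=
          ((Nat.prime_iff_prime_int.1 hp).coprime_iff_not_dvd.2 hnd).symm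
        obtain ⟨u, v, huv⟩ := hcop
        refine hap ⟨b ^ u * a ^ v, ?_⟩
        rw [mul_pow, ← zpow_natCast (b ^ u), zpow_comm, zpow_natCast b, ← hb, ← zpow_mul,
          ← zpow_natCast (a ^ v), ← zpow_mul, ← zpow_add, mul_comm _ u, huv, zpow_one]
      have h1 : ψ (rootPow _ p x) = 1 := by
        obtain ⟨c, hc⟩ := hpk
        rw [← hk]
        refine (hψ k.toAdd).trans ?_
        rw [hc, zpow_mul, zpow_natCast, hζ, one_zpow]
      rw [MonoidHom.mul_apply, MonoidHom.comp_apply, h1, mul_one]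
      rfl)
  refine ⟨galRestrict Γ σ, ⟨σ, rfl⟩, hσ1, fun x hx => ?_⟩
  have hxm : (x : ℂˣ) ∈ rootGroup (Subgroup.zpowers a) p := ⟨a, Subgroup.mem_zpowers a, hx.symm⟩
  rw [hσ2 x hxm]
  have hrp : rootPow (Subgroup.zpowers a) p ⟨x, hxm⟩ = e (Multiplicative.ofAdd 1) := by
    refine Subtype.ext (ratUnits_injective ?_)
    rw [ratUnits_rootPow, he, zpow_one]
    exact hx
  rw [MonoidHom.mul_apply, MonoidHom.comp_apply, hrp, hψ, zpow_one]
  rfl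

end IndexBound

/-! ### Positive density -/

section Positivity

variable {n : ℕ} {a : Fin n → ℚˣ}

/-- The subset of `Γ_∞` on which elements of `kerRestrict a p i` are trivial. -/
def rootsOfGenerator (a : Fin n → ℚˣ) (p : ℕ) (i : Fin n) : Set (radicalGroup (genGroup a)) :=
  {x | (x : ℂˣ) ∈ rootGroup (Subgroup.zpowers (a i)) p}

theorem root_mem_rootsOfGenerator {p : ℕ} {i : Fin n} {x : radicalGroup (genGroup a)}
    (hx : (x : ℂˣ) ^ p = ratUnits (a i)) : x ∈ rootsOfGenerator a p i :=
  ⟨a i, Subgroup.mem_zpowers _, hx.symm⟩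

theorem rootOfUnity_mem_rootsOfGenerator {p : ℕ} {i : Fin n} {z : radicalGroup (genGroup a)}
    (hz : z ^ p = 1) : z ∈ rootsOfGenerator a p i := by
  refine ⟨1, one_mem _, ?_⟩
  have := congrArg Subtype.val hz
  rw [map_one]
  exact this.symm

open scoped Pointwise in
/-- Let the elements of `E` be `N`-th roots of unity or sixth roots of rational numbers, with
`6 ∣ N`. If `p` is prime to `N` and `a_i` is not a `p`-th power, then the elements of a coset of the
Galois group over `ℚ(E)` that are trivial on `Γ_i^{1/p}` have relative measure at most `12 / p ^ 2`.
Sixth powers are used to obtain automorphisms that are trivial on `E`. -/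
theorem haarA_coset_inter_kerRestrict_le (ha : ∀ i, a i ≠ 1 ∧ a i ≠ -1)
    {E : Set (radicalGroup (genGroup a))} {N : ℕ} (hN : 1 ≤ N) (h6 : 6 ∣ N)
    (hE : ∀ x ∈ E, x ^ N = 1 ∨ ((x ^ 6 : radicalGroup (genGroup a)) : ℂˣ) ∈ ratUnits.range)
    {p : ℕ} (hp : p.Prime) (hpN : N.Coprime p) {i : Fin n} (hap : ¬ ∃ b : ℚˣ, a i = b ^ p)
    (g : radAut (genGroup a)) :
    (p ^ 2 : ℕ) * haarA (genGroup a)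
        (g • (galoisFixing (genGroup a) E : Set (radAut (genGroup a))) ∩ kerRestrict a p i) ≤
      12 * haarA (genGroup a) (galoisFixing (genGroup a) E) := by
  have := Fact.mk hp
  let Γ := genGroup a
  let H := galoisFixing Γ E
  let D := galoisFixing Γ (E ∪ rootsOfGenerator a p i)
  have hDH : D ≤ H := fun α hα => ⟨hα.1, fun x hx => hα.2 x (Or.inl hx)⟩
  -- A nonempty intersection of the coset with `kerRestrict` is contained in a coset of `D`.
  have hcoset : haarA Γ (g • (H : Set (radAut Γ)) ∩ kerRestrict a p i) ≤ haarA Γ D := by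
    rcases Set.eq_empty_or_nonempty (g • (H : Set (radAut Γ)) ∩ kerRestrict a p i) with
      h | ⟨y, hy, hyK⟩
    · rw [h, measure_empty]
      exact zero_le
    · rw [← haarA_smul y (D : Set (radAut Γ))]
      refine measure_mono ?_
      rintro x ⟨hx, hxK⟩
      rw [Set.mem_smul_set_iff_inv_smul_mem] at hx hy ⊢
      have hxy : y⁻¹ * x ∈ H := by
        have := mul_mem (inv_mem hy) hx
        have he : (g⁻¹ • y)⁻¹ * g⁻¹ • x = y⁻¹ * x := by
          simp only [smul_eq_mul]
          group
        rwa [he] at this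
      refine ⟨hxy.1, ?_⟩
      rintro w (hw | hw)
      · exact hxy.2 w hw
      · change act (y⁻¹ * x) w = w
        rw [act_mul, hxK w hw, act_inv_eq_iff, hyK w hw]
  have hp6 : Nat.Coprime 6 p := Nat.Coprime.coprime_dvd_left h6 hpN
  have hp2 : p ≠ 2 := by
    rintro rfl
    exact absurd hp6 (by norm_num)
  obtain ⟨ζ, hζ⟩ := exists_isPrimitiveRoot Γ hp.one_le
  obtain ⟨x, hx⟩ := exists_root (mem_genGroup a i) hp.one_le
  obtain ⟨τ, hτ, hτ1, hτ2⟩ := exists_galois_mul_root (mem_genGroup a i) (ha i).1 (ha i).2 hp hp2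
    hap hζ.pow_eq_one
  have hsix : ∀ ρ : radAut Γ, ρ ∈ (galRestrict Γ).range →
      (∀ z : radicalGroup Γ, z ^ N = 1 → act ρ z = z) → ρ ^ 6 ∈ H := by
    intro ρ hρ hρ1
    refine ⟨pow_mem hρ 6, fun y hy => ?_⟩
    rcases hE y hy with h | h
    · have hfix := hρ1 y h
      have : ∀ l : ℕ, act (ρ ^ l) y = y := by
        intro l
        induction l with
        | zero => rfl
        | succ l ih => rw [pow_succ, act_mul, hfix, ih]
      exact this 6
    · refine act_pow_eq_self (fun z hz => hρ1 z ?_) h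
      obtain ⟨c, rfl⟩ := h6
      rw [pow_mul, hz, one_pow]
  let R := (powMonoidHom 6 : (ZMod p)ˣ →* (ZMod p)ˣ).range
  have hρ : ∀ w : R, ∃ ρ ∈ H, ∀ z : radicalGroup Γ, z ^ p = 1 →
      act ρ z = z ^ ((w : (ZMod p)ˣ) : ZMod p).val := by
    rintro ⟨_, u, rfl⟩
    obtain ⟨ρ, hρ, hρ1, hρ2⟩ := exists_galois_crt Γ hN hp.one_le hpN (ZMod.val_coe_unit_coprime u)
    refine ⟨ρ ^ 6, hsix ρ hρ hρ1, fun z hz => ?_⟩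
    have hpow : ∀ l : ℕ, act (ρ ^ l) z = z ^ ((u : ZMod p).val ^ l) := by
      intro l
      induction l with
      | zero => simp [act_one]
      | succ l ih =>
        rw [pow_succ', act_mul, ih, act_map_pow, hρ2 z hz, ← pow_mul, ← pow_succ']
    rw [hpow 6]
    refine pow_eq_pow_iff_modEq.2 (Nat.ModEq.of_dvd (orderOf_dvd_of_pow_eq_one hz) ?_)
    rw [← ZMod.natCast_eq_natCast_iff]
    simp
  choose ρ hρH hρ using hρ
  have hτ6 : τ ^ 6 ∈ H := hsix τ hτ fun z hz =>
    hτ1 z (isOfFinOrder_iff_pow_eq_one.2 ⟨N, hN, hz⟩)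
  have hτζ : act τ ζ = ζ := hτ1 ζ (isOfFinOrder_iff_pow_eq_one.2 ⟨p, hp.pos, hζ.pow_eq_one⟩)
  have hτpow : ∀ l : ℕ, act (τ ^ l) x = x * ζ ^ l ∧ act (τ ^ l) ζ = ζ := by
    intro l
    induction l with
    | zero => simp [act_one]
    | succ l ih =>
      constructor
      · rw [pow_succ', act_mul, ih.1, act_map_mul, act_map_pow, hτζ, hτ2 x hx, mul_assoc, ← pow_succ']
      · rw [pow_succ', act_mul, ih.2, hτζ]
  let f : R × ZMod p → radAut Γ := fun j => ρ j.1 * (τ ^ 6) ^ j.2.val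
  have hfζ : ∀ j, act (f j) ζ = ζ ^ ((j.1 : (ZMod p)ˣ) : ZMod p).val := by
    intro j
    rw [act_mul, ← pow_mul, (hτpow _).2, hρ _ _ hζ.pow_eq_one]
  have hinj : ∀ j k, (f j)⁻¹ * f k ∈ D → j = k := by
    intro j k hjk
    have hagree : ∀ y ∈ rootsOfGenerator a p i, act (f k) y = act (f j) y := by
      intro y hy
      have := hjk.2 y (Or.inr hy)
      rwa [act_mul, act_inv_eq_iff] at this
    have h1 := hagree ζ (rootOfUnity_mem_rootsOfGenerator hζ.pow_eq_one)
    rw [hfζ, hfζ] at h1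
    have h1' : j.1 = k.1 := Subtype.ext (Units.ext (ZMod.val_injective p
      (hζ.pow_inj (ZMod.val_lt _) (ZMod.val_lt _) h1.symm)))
    have h2 := hagree x (root_mem_rootsOfGenerator hx)
    have h3 : ζ ^ (6 * k.2.val) = ζ ^ (6 * j.2.val) := by
      rw [act_mul, act_mul, ← h1'] at h2
      have := act_injective _ h2
      rw [← pow_mul, ← pow_mul, (hτpow _).1, (hτpow _).1] at this
      exact mul_left_cancel this
    have h4 : 6 * k.2.val ≡ 6 * j.2.val [MOD p] := by
      have := pow_eq_pow_iff_modEq.1 h3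
      rwa [← hζ.eq_orderOf] at this
    have h5 : k.2.val ≡ j.2.val [MOD p] := Nat.ModEq.cancel_left_of_coprime hp6.symm h4
    rw [← ZMod.natCast_eq_natCast_iff, ZMod.natCast_zmod_val, ZMod.natCast_zmod_val] at h5
    exact Prod.ext h1' h5.symm
  have hcard := card_mul_haarA_le hDH (isClosed_galoisFixing _) f
    (fun j => mul_mem (hρH _) (pow_mem hτ6 _)) hinj
  have hnum : p ^ 2 ≤ 12 * Fintype.card (R × ZMod p) := by
    have h1 := le_six_mul_card_sixth_powers p
    rw [Fintype.card_prod, ZMod.card, ← Nat.card_eq_fintype_card]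
    have h2 := hp.two_le
    calc p ^ 2 = p * p := sq p
      _ ≤ (2 * (p - 1)) * p := Nat.mul_le_mul_right _ (by omega)
      _ ≤ (2 * (6 * Nat.card R)) * p := Nat.mul_le_mul_right _ (Nat.mul_le_mul_left _ h1)
      _ = 12 * (Nat.card R * p) := by ring
  calc ((p ^ 2 : ℕ) : ENNReal) * haarA Γ (g • (H : Set (radAut Γ)) ∩ kerRestrict a p i)
      ≤ ((12 * Fintype.card (R × ZMod p) : ℕ) : ENNReal) * haarA Γ D := by
        gcongr
    _ = 12 * ((Fintype.card (R × ZMod p) : ENNReal) * haarA Γ D) := by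
        push_cast
        ring
    _ ≤ 12 * haarA Γ H := by gcongr

open scoped Pointwise in
/-- If condition (a) or condition (b) fails, `G ∩ S` has positive measure: in a coset of an open
subgroup of `G` that satisfies the local conditions at the small primes, only a small proportion
violates one of the remaining local conditions. -/
theorem haarA_galois_inter_goodSet_pos (ha : ∀ i, a i ≠ 1 ∧ a i ≠ -1) (h : NoOddSquare a)
    (hAB : ¬ (CondA a h ∧ CondB a)) :
    0 < haarA (genGroup a) (galoisImage (genGroup a) ∩ goodSet a) := by
  set Γ := genGroup a with hΓ
  choose P₀ hP₀ using fun i => exists_forall_not_pow (ha i).1 (ha i).2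
  let c : ℕ → ENNReal := fun m => ENNReal.ofReal (12 * n / (m : ℝ) ^ 2)
  have hc : ∑' m, c m ≠ ⊤ := by
    refine Summable.tsum_ofReal_ne_top ?_
    simp_rw [div_eq_mul_inv]
    exact (Real.summable_nat_pow_inv.2 (by norm_num)).mul_left _
  obtain ⟨P₁, hP₁⟩ := ((tendsto_order.1 (ENNReal.tendsto_sum_nat_add c hc)).2 1
    zero_lt_one).exists_forall_of_atTop
  let P : ℕ := P₁ + 3 + ∑ i, P₀ i
  have hP3 : 3 ≤ P := by omega
  have hPi : ∀ i, P₀ i ≤ P := fun i =>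
    (Finset.single_le_sum (f := P₀) (fun _ _ => Nat.zero_le _) (Finset.mem_univ i)).trans (by omega)
  obtain ⟨g, hg, hg2, hg3, hg5⟩ := exists_galois_locally_good h hAB P
  let N : ℕ := P.factorial
  have hN : 1 ≤ N := Nat.factorial_pos P
  have h6 : 6 ∣ N := Nat.factorial_dvd_factorial hP3
  choose r₂ hr₂ using fun i => exists_root (mem_genGroup a i) (k := 2) (by norm_num)
  choose r₃ hr₃ using fun i => exists_root (mem_genGroup a i) (k := 3) (by norm_num)
  let E : Set (radicalGroup Γ) := {z | z ^ N = 1} ∪ (Set.range r₂ ∪ Set.range r₃)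
  have hEfin : E.Finite := by
    refine Set.Finite.union ?_ ((Set.finite_range _).union (Set.finite_range _))
    simpa using finite_roots (1 : radicalGroup Γ) hN
  have hE : ∀ x ∈ E, x ^ N = 1 ∨ ((x ^ 6 : radicalGroup Γ) : ℂˣ) ∈ ratUnits.range := by
    rintro x (hx | ⟨i, rfl⟩ | ⟨i, rfl⟩)
    · exact Or.inl hx
    · refine Or.inr ⟨a i ^ 3, ?_⟩
      rw [map_pow, ← hr₂ i, ← pow_mul]
      rfl
    · refine Or.inr ⟨a i ^ 2, ?_⟩
      rw [map_pow, ← hr₃ i, ← pow_mul]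
      rfl
  let H := galoisFixing Γ E
  have hHpos : 0 < haarA Γ H := haarA_galoisFixing_pos a hEfin
  have hsmall : ∀ p : ℕ, p.Prime → p ≤ P → ∀ i, ∃ x ∈ E, x ∈ rootsOfGenerator a p i ∧
      act g x ≠ x := by
    intro p hp hpP i
    have hdvd : p ∣ N := Nat.dvd_factorial hp.pos hpP
    have hunity : (∃ z : radicalGroup Γ, z ^ p = 1 ∧ act g z ≠ z) →
        ∃ x ∈ E, x ∈ rootsOfGenerator a p i ∧ act g x ≠ x := by
      rintro ⟨z, hz, hgz⟩
      refine ⟨z, Or.inl ?_, rootOfUnity_mem_rootsOfGenerator hz, hgz⟩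
      obtain ⟨d, hd⟩ := hdvd
      change z ^ N = 1
      rw [hd, pow_mul, hz, one_pow]
    rcases lt_or_ge p 5 with hp5 | hp5
    · have h2 := hp.two_le
      have : p = 2 ∨ p = 3 := by
        have : p ≠ 4 := by rintro rfl; exact absurd hp (by norm_num)
        omega
      rcases this with rfl | rfl
      · exact ⟨r₂ i, Or.inr (Or.inl ⟨i, rfl⟩), root_mem_rootsOfGenerator (hr₂ i), hg2 i _ (hr₂ i)⟩
      · rcases hg3 i with hz | hx
        · exact hunity hz
        · exact ⟨r₃ i, Or.inr (Or.inr ⟨i, rfl⟩), root_mem_rootsOfGenerator (hr₃ i),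
            hx _ (hr₃ i)⟩
    · exact hunity (hg5 p hp hp5 hpP)
  let B : ℕ → Fin n → Set (radAut Γ) := fun k i => {α | (k + P).Prime ∧ P < k + P ∧
    α ∈ g • (H : Set (radAut Γ)) ∩ kerRestrict a (k + P) i}
  have hcover : g • (H : Set (radAut Γ)) ⊆
      (galoisImage Γ ∩ goodSet a) ∪ ⋃ k, ⋃ i, B k i := by
    intro α hα
    have hα' := hα
    rw [Set.mem_smul_set_iff_inv_smul_mem] at hα'
    by_cases hgood : α ∈ goodSet a
    · refine Or.inl ⟨?_, hgood⟩
      rw [galoisImage_eq_range]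
      have := mul_mem hg hα'.1
      simpa using this
    · right
      simp only [goodSet, Set.mem_iInter, not_forall] at hgood
      obtain ⟨⟨p, hp⟩, hgood⟩ := hgood
      simp only [localGood, Set.mem_compl_iff, not_not, Set.mem_iUnion] at hgood
      obtain ⟨i, hi⟩ := hgood
      rcases le_or_gt p P with hpP | hpP
      · exfalso
        obtain ⟨x, hxE, hxr, hx⟩ := hsmall p hp hpP i
        have h1 : act α x = x := hi x hxr
        have h2 : act (g⁻¹ * α) x = x := hα'.2 x hxE
        rw [act_mul, h1, act_inv_eq_iff] at h2
        exact hx h2.symm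
      · simp only [Set.mem_iUnion]
        refine ⟨p - P, i, ?_⟩
        have : p - P + P = p := by omega
        change (p - P + P).Prime ∧ P < p - P + P ∧ _ ∈ _ ∩ kerRestrict a (p - P + P) i
        rw [this]
        exact ⟨hp, hpP, hα, hi⟩
  have hB : ∀ k i, haarA Γ (B k i) ≤ ENNReal.ofReal (12 / ((k + P : ℕ) : ℝ) ^ 2) * haarA Γ H := by
    intro k i
    by_cases hk : (k + P).Prime ∧ P < k + P
    · have hcop : N.Coprime (k + P) := by
        refine Nat.Coprime.symm ((Nat.Prime.coprime_iff_not_dvd hk.1).2 fun hd => ?_)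
        exact absurd ((Nat.Prime.dvd_factorial hk.1).1 hd) (not_le.2 hk.2)
      have hle := haarA_coset_inter_kerRestrict_le ha hN h6 hE hk.1 hcop (i := i)
        (hP₀ i _ ((hPi i).trans hk.2.le)) g
      have hBsub : B k i ⊆ g • (H : Set (radAut Γ)) ∩ kerRestrict a (k + P) i := fun α hα => hα.2.2
      refine (measure_mono hBsub).trans ?_
      have hpos : (0 : ℝ) < ((k + P : ℕ) : ℝ) ^ 2 := by
        have := hk.1.pos
        positivity
      rw [ENNReal.ofReal_div_of_pos hpos, ENNReal.ofReal_pow (by positivity),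
        ENNReal.ofReal_natCast, ENNReal.ofReal_ofNat, ENNReal.mul_comm_div, ← mul_div_assoc,
        ENNReal.le_div_iff_mul_le (Or.inl (by simpa using hk.1.ne_zero)) (Or.inl (by simp))]
      rw [mul_comm]
      push_cast at hle ⊢
      exact hle
    · have : B k i = ∅ := by
        ext α
        simp only [Set.mem_empty_iff_false, iff_false]
        exact fun hα => hk ⟨hα.1, hα.2.1⟩
      rw [this, measure_empty]
      exact zero_le
  have hsum : haarA Γ (⋃ k, ⋃ i, B k i) ≤ (∑' k, c (k + P)) * haarA Γ H := by
    refine (measure_iUnion_le _).trans ?_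
    rw [← ENNReal.tsum_mul_right]
    refine ENNReal.tsum_le_tsum fun k => ?_
    refine (measure_iUnion_fintype_le _ _).trans ?_
    refine (Finset.sum_le_sum fun i _ => hB k i).trans ?_
    rw [Finset.sum_const, Finset.card_univ, Fintype.card_fin, nsmul_eq_mul, ← mul_assoc]
    gcongr
    change _ ≤ ENNReal.ofReal _
    rw [← ENNReal.ofReal_natCast n, ← ENNReal.ofReal_mul (by positivity)]
    exact le_of_eq (congrArg _ (by ring))
  have hlt : ∑' k, c (k + P) < 1 := hP₁ P (by omega)
  by_contra hzero
  have hzero' : haarA Γ (galoisImage Γ ∩ goodSet a) = 0 := by simpa using hzero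
  have hfin : haarA Γ H ≠ ⊤ := measure_ne_top _ _
  have h1 : haarA Γ H ≤ (∑' k, c (k + P)) * haarA Γ H := by
    calc haarA Γ H = haarA Γ (g • (H : Set (radAut Γ))) := (haarA_smul g _).symm
      _ ≤ haarA Γ (galoisImage Γ ∩ goodSet a) + haarA Γ (⋃ k, ⋃ i, B k i) :=
        (measure_mono hcover).trans (measure_union_le _ _)
      _ ≤ _ := by rw [hzero', zero_add]; exact hsum
  have h2 : (∑' k, c (k + P)) * haarA Γ H < 1 * haarA Γ H :=
    ENNReal.mul_lt_mul_left hHpos.ne' hfin hlt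
  rw [one_mul] at h2
  exact absurd (h1.trans_lt h2) (lt_irrefl _)

end Positivity

/-! ### Conditions (a) and (b) exclude all Galois automorphisms -/

section Emptiness

variable {n : ℕ} {a : Fin n → ℚˣ}

/-- An element of `A` acts trivially on `Γ_i^{1/p}` if it fixes `μ_p` and one `p`-th root of
`a_i`. -/
theorem mem_kerRestrict_of_fixed {p : ℕ} {i : Fin n} {α : radAut (genGroup a)}
    (hα : ∀ z : radicalGroup (genGroup a), z ^ p = 1 → act α z = z)
    {r : radicalGroup (genGroup a)} (hr : (r : ℂˣ) ^ p = ratUnits (a i)) (hαr : act α r = r) :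
    α ∈ kerRestrict a p i := by
  rintro x ⟨_, ⟨k, rfl⟩, hx⟩
  have h1 : (x / r ^ k) ^ p = 1 := by
    rw [div_pow, div_eq_one]
    refine Subtype.ext ?_
    change (x : ℂˣ) ^ p = ((r : ℂˣ) ^ k) ^ p
    rw [← zpow_natCast ((r : ℂˣ) ^ k), zpow_comm, zpow_natCast, hr, ← map_zpow]
    exact hx.symm
  have h2 : act α (r ^ k) = r ^ k := by
    have : act α (r ^ k) = act α r ^ k := map_zpow α.1 r k
    rw [this, hαr]
  have h3 : x = x / r ^ k * r ^ k := by rw [div_mul_cancel]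
  rw [h3, act_map_mul, hα _ h1, h2]

theorem act_eq_self_of_sq_eq_one {Γ : Subgroup ℚˣ} (α : radAut Γ) {z : radicalGroup Γ}
    (hz : z ^ 2 = 1) : act α z = z := by
  apply act_eq_self_of_mem_range
  have h : ((z : ℂˣ) : ℂ) ^ 2 = 1 := congrArg (fun t : radicalGroup Γ => ((t : ℂˣ) : ℂ)) hz
  rcases sq_eq_one_iff.1 h with h | h
  · exact ⟨1, Units.ext (by rw [h]; simp)⟩
  · exact ⟨-1, Units.ext (by rw [h]; simp [ratUnits_coe])⟩

/-- A Galois automorphism that changes the sign of all `√a_i` acts on the square root of an element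
of the kernel of `w_2` trivially; under condition (a) it therefore fixes the
cube roots of unity. -/
theorem act_eq_self_of_condA (h : NoOddSquare a) (hA : CondA a h)
    (σ : radicalField (genGroup a) ≃ₐ[ℚ] radicalField (genGroup a))
    (r : Fin n → radicalGroup (genGroup a)) (hr : ∀ i, (r i : ℂˣ) ^ 2 = ratUnits (a i))
    (hσ : ∀ i, σ (toField (r i)) = -toField (r i)) {z : radicalGroup (genGroup a)}
    (hz : z ^ 3 = 1) : act (galRestrict (genGroup a) σ) z = z := by
  let L := radicalField (genGroup a)
  let f : ℚˣ →* Lˣ := Units.map (algebraMap ℚ L : ℚ →* L)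
  let c : ℤˣ →* Lˣ := Units.map (Int.castRingHom L : ℤ →* L)
  let s : Lˣ →* Lˣ := Units.map (σ : L →* L)
  let q : Fin n → Lˣ := fun i => Units.mk0 (toField (r i)) (toField_ne_zero _)
  have hq : ∀ i, q i ^ 2 = f (a i) := fun i => Units.ext (by
    have : toField (r i ^ 2) = algebraMap ℚ L (a i : ℚ) :=
      toField_eq_algebraMap_iff.2 (by simpa using hr i)
    exact this)
  have hs : ∀ i, s (q i) = c (-1) * q i := fun i => Units.ext (by
    refine (hσ i).trans ?_
    simp [c, q])
  obtain ⟨y, hy, hy3⟩ := (condA_iff h).1 hA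
  obtain ⟨e, rfl⟩ := expMap_surjective a 2 y
  have hw : ∏ i, (-1 : ℤˣ) ^ (e.toAdd i) = 1 := by
    refine Eq.trans ?_ hy
    change _ = w2 a h (∏ i, genClass a 2 i ^ (e.toAdd i))
    rw [map_prod]
    exact Finset.prod_congr rfl fun i _ => by rw [map_zpow, w2_genClass]
  have hcl : classMap 2 negThree = classMap 2 (∏ i, a i ^ (e.toAdd i)) := by
    rw [hy3]
    change ((∏ i, genClass a 2 i ^ (e.toAdd i) : barGroup (genGroup a) 2) :
      ℚˣ ⧸ (powMonoidHom 2 : ℚˣ →* ℚˣ).range) = _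
    rw [map_prod, Subgroup.val_finsetProd]
    exact Finset.prod_congr rfl fun i _ => by rw [map_zpow]; rfl
  obtain ⟨b, hb⟩ := QuotientGroup.eq.1 hcl.symm
  have hb' : negThree = (∏ i, a i ^ (e.toAdd i)) * b ^ 2 := by
    have : b ^ 2 = (∏ i, a i ^ (e.toAdd i))⁻¹ * negThree := hb
    rw [this, mul_inv_cancel_left]
  let t : Lˣ := (∏ i, q i ^ (e.toAdd i)) * f b
  have ht : t ^ 2 = f negThree := by
    rw [hb', map_mul, map_pow, map_prod, mul_pow, ← Finset.prod_pow]
    congr 1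
    refine Finset.prod_congr rfl fun i _ => ?_
    rw [map_zpow, ← hq, ← zpow_natCast, zpow_comm, zpow_natCast]
  have hst : s t = t := by
    have h1 : s (f b) = f b := Units.ext (σ.commutes b)
    have h2 : s (∏ i, q i ^ (e.toAdd i)) = ∏ i, q i ^ (e.toAdd i) := by
      rw [map_prod]
      simp_rw [map_zpow, hs, mul_zpow, ← map_zpow]
      rw [Finset.prod_mul_distrib, ← map_prod, hw, map_one, one_mul]
    rw [map_mul, h1, h2]
  obtain ⟨ω, hω⟩ := exists_isPrimitiveRoot (genGroup a) (m := 3) (by norm_num)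
  have hsq := sq_two_mul_add_one_eq hω
  have hσs : σ (2 * toField ω + 1) = 2 * toField ω + 1 := by
    have h1 : (2 * toField ω + 1) ^ 2 = (t : L) ^ 2 := hsq.trans (congrArg Units.val ht).symm
    have h2 : σ (t : L) = t := congrArg Units.val hst
    rcases sq_eq_sq_iff_eq_or_eq_neg.1 h1 with h | h
    · rw [h, h2]
    · rw [h, map_neg, h2]
  have hσω : act (galRestrict (genGroup a) σ) ω = ω := by
    apply toField_injective
    rw [toField_act_galRestrict]
    rw [map_add, map_mul, map_ofNat, map_one] at hσs
    exact mul_left_cancel₀ two_ne_zero (add_right_cancel hσs)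
  obtain ⟨k, -, rfl⟩ := exists_pow_of_isPrimitiveRoot (by norm_num) hω hz
  rw [act_map_pow, hσω]

/-- An element of `A` that fixes the cube roots of unity acts on the cube roots of `Γ` through a
character of `Γ̄_3`. -/
theorem exists_cubic_character {Γ : Subgroup ℚˣ} (α : radAut Γ)
    (hα : ∀ z : radicalGroup Γ, z ^ 3 = 1 → act α z = z) :
    ∃ χ : barGroup Γ 3 →* rootsOfUnity 3 ℂ, ∀ (x : radicalGroup Γ) (γ : ℚˣ) (hγ : γ ∈ Γ),
      (x : ℂˣ) ^ 3 = ratUnits γ →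
        ((act α x : radicalGroup Γ) : ℂˣ) = χ ⟨classMap 3 γ, γ, hγ, rfl⟩ * x := by
  have hle : rootGroup Γ 3 ≤ radicalGroup Γ := rootGroup_le le_rfl (by norm_num)
  let j := Subgroup.inclusion hle
  let cl : rootGroup Γ 3 →* barGroup Γ 3 := ((classMap 3).subgroupMap Γ).comp (rootPow Γ 3)
  have hclval : ∀ x, (cl x : ℚˣ ⧸ (powMonoidHom 3 : ℚˣ →* ℚˣ).range) =
      classMap 3 (rootPow Γ 3 x : ℚˣ) := fun _ => rfl
  have hclsurj : Function.Surjective cl := by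
    rintro ⟨_, γ, hγ, rfl⟩
    obtain ⟨x, hx⟩ := exists_root hγ (k := 3) (by norm_num)
    refine ⟨⟨x, γ, hγ, hx.symm⟩, Subtype.ext ?_⟩
    rw [hclval]
    congr 1
    exact ratUnits_injective ((ratUnits_rootPow _).trans hx)
  let d : rootGroup Γ 3 →* ℂˣ := (radicalGroup Γ).subtype.comp
    (((α.1 : radicalGroup Γ →* radicalGroup Γ).comp j) / j)
  have hd : ∀ x, d x = ((act α (j x) / j x : radicalGroup Γ) : ℂˣ) := fun _ => rfl
  let δ : rootGroup Γ 3 →* rootsOfUnity 3 ℂ := d.codRestrict _ fun x => by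
    rw [mem_rootsOfUnity, hd, ← Subgroup.coe_pow, div_pow, ← act_map_pow,
      act_eq_self_of_mem_range α ⟨rootPow Γ 3 x, ratUnits_rootPow x⟩, div_self']
    rfl
  have hker : cl.ker ≤ δ.ker := by
    intro x hx
    obtain ⟨b, hb⟩ := (QuotientGroup.eq_one_iff _).1 (congrArg Subtype.val hx)
    have hb3 : b ^ 3 = rootPow Γ 3 x := hb
    have hbm : ratUnits b ∈ radicalGroup Γ :=
      mem_radicalGroup_of_pow (m := 3) (by norm_num) (rootPow Γ 3 x).2 (by rw [← hb3, map_pow])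
    have h1 : (j x / ⟨_, hbm⟩ : radicalGroup Γ) ^ 3 = 1 := by
      rw [div_pow, div_eq_one]
      refine Subtype.ext ?_
      change (x : ℂˣ) ^ 3 = ratUnits b ^ 3
      rw [← map_pow, hb3, ratUnits_rootPow]
    have h2 : act α (j x) = j x := by
      have h3 : j x = j x / ⟨_, hbm⟩ * ⟨_, hbm⟩ := by rw [div_mul_cancel]
      rw [h3, act_map_mul, hα _ h1, act_eq_self_of_mem_range α (x := ⟨_, hbm⟩) ⟨b, rfl⟩]
    refine Subtype.ext ?_
    change d x = 1
    rw [hd, h2, div_self']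
    rfl
  refine ⟨cl.liftOfSurjective hclsurj ⟨δ, hker⟩, fun x γ hγ hx => ?_⟩
  have hval := cl.liftOfRightInverse_comp_apply _ (Function.rightInverse_surjInv hclsurj)
    ⟨δ, hker⟩ ⟨x, γ, hγ, hx.symm⟩
  have hclx : cl ⟨x, γ, hγ, hx.symm⟩ = ⟨classMap 3 γ, γ, hγ, rfl⟩ := by
    refine Subtype.ext ?_
    rw [hclval]
    congr 1
    exact ratUnits_injective ((ratUnits_rootPow _).trans hx)
  rw [hclx] at hval
  refine Eq.trans ?_ (congrArg (fun t : rootsOfUnity 3 ℂ => (t : ℂˣ) * x) hval.symm)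
  change _ = ((act α x / x : radicalGroup Γ) : ℂˣ) * x
  rw [← Subgroup.coe_mul, div_mul_cancel]

/-- Under conditions (a) and (b) no element of the Galois group satisfies the local conditions at
both `2` and `3`. -/
theorem galoisImage_inter_goodSet_eq_empty (h : NoOddSquare a) (hA : CondA a h) (hB : CondB a) :
    galoisImage (genGroup a) ∩ goodSet a = ∅ := by
  rw [Set.eq_empty_iff_forall_notMem]
  rintro α ⟨hα, hgood⟩
  rw [galoisImage_eq_range] at hα
  obtain ⟨σ, rfl⟩ := hα
  have hnot : ∀ (p : Nat.Primes) i, galRestrict (genGroup a) σ ∉ kerRestrict a p i := by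
    intro p i hi
    exact Set.mem_iInter.1 hgood p (Set.mem_iUnion.2 ⟨i, hi⟩)
  choose r₂ hr₂ using fun i => exists_root (mem_genGroup a i) (k := 2) (by norm_num)
  have hneg : ∀ i, σ (toField (r₂ i)) = -toField (r₂ i) := by
    intro i
    have h1 : act (galRestrict (genGroup a) σ) (r₂ i) ≠ r₂ i := fun hfix =>
      hnot ⟨2, Nat.prime_two⟩ i
        (mem_kerRestrict_of_fixed (fun z hz => act_eq_self_of_sq_eq_one _ hz) (hr₂ i) hfix)
    have h2 : toField (r₂ i) ^ 2 = algebraMap ℚ _ (a i : ℚ) := by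
      rw [← toField_pow]
      exact toField_eq_algebraMap_iff.2 (by simpa using hr₂ i)
    have h3 : σ (toField (r₂ i)) ^ 2 = toField (r₂ i) ^ 2 := by
      rw [← map_pow, h2, AlgEquiv.commutes]
    refine (sq_eq_sq_iff_eq_or_eq_neg.1 h3).resolve_left fun h4 => h1 ?_
    exact toField_injective ((toField_act_galRestrict _ _).trans h4)
  have hfix3 : ∀ z : radicalGroup (genGroup a), z ^ 3 = 1 →
      act (galRestrict (genGroup a) σ) z = z := fun z hz =>
    act_eq_self_of_condA h hA σ r₂ hr₂ hneg hz
  obtain ⟨χ, hχ⟩ := exists_cubic_character _ hfix3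
  obtain ⟨i, hi⟩ := hB χ
  obtain ⟨r, hr⟩ := exists_root (mem_genGroup a i) (k := 3) (by norm_num)
  refine hnot ⟨3, Nat.prime_three⟩ i (mem_kerRestrict_of_fixed hfix3 hr (Subtype.ext ?_))
  rw [hχ r (a i) (mem_genGroup a i) hr]
  have : χ ⟨classMap 3 (a i), a i, mem_genGroup a i, rfl⟩ = 1 := hi
  rw [this]
  exact one_mul _

end Emptiness

/-! ### Characters of `Γ̄_3` without zeros on the generators -/

section CubicCharacters

/-- A vector space over `𝔽_3` spanned by `n` nonzero vectors, of dimension at least `n - 1`, has a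
linear form that does not vanish on any of them. All but at most one of the vectors form a basis,
and a form that is nonzero on the basis can be modified at one basis vector. -/
theorem exists_linearForm_ne_zero {n : ℕ} {V : Type*} [AddCommGroup V] [Module (ZMod 3) V]
    (v : Fin n → V) (hspan : Submodule.span (ZMod 3) (Set.range v) = ⊤) (hv : ∀ i, v i ≠ 0)
    (hr : n ≤ Module.finrank (ZMod 3) V + 1) : ∃ f : V →ₗ[ZMod 3] ZMod 3, ∀ i, f (v i) ≠ 0 := by
  classical
  have h2 : (1 + 1 : ZMod 3) ≠ 0 := by decide
  have h1 : (1 + 0 : ZMod 3) ≠ 0 := by decide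
  have := Fact.mk Nat.prime_three
  obtain ⟨κ, u, hu, hsp, hlin⟩ := exists_linearIndependent' (ZMod 3) v
  have : Fintype κ := @Fintype.ofFinite κ (Finite.of_injective u hu)
  let b : Module.Basis κ (ZMod 3) V := Module.Basis.mk hlin (by rw [hsp, hspan])
  have hb : ∀ k, b k = v (u k) := fun k => by simp [b]
  let f : V →ₗ[ZMod 3] ZMod 3 := b.constr (ZMod 3) fun _ => (1 : ZMod 3)
  have hf : ∀ k, f (v (u k)) = 1 := fun k => by rw [← hb]; simp [f]
  by_cases hsurj : Function.Surjective u
  · refine ⟨f, fun i => ?_⟩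
    obtain ⟨k, rfl⟩ := hsurj i
    rw [hf]
    exact one_ne_zero
  · rw [Function.Surjective] at hsurj
    push Not at hsurj
    obtain ⟨j, hj⟩ := hsurj
    have hrange : ∀ i, i ≠ j → ∃ k, u k = i := by
      intro i hij
      by_contra! hi
      have hcard : Fintype.card κ + 2 ≤ n := by
        have h1 : (Finset.univ.image u) ∪ {i, j} ⊆ (Finset.univ : Finset (Fin n)) :=
          Finset.subset_univ _
        have h2 := Finset.card_le_card h1
        rw [Finset.card_union_of_disjoint, Finset.card_image_of_injective _ hu,
          Finset.card_pair hij, Finset.card_univ, Finset.card_univ, Fintype.card_fin] at h2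
        · exact h2
        · rw [Finset.disjoint_left]
          intro x hx hx'
          obtain ⟨k, -, rfl⟩ := Finset.mem_image.1 hx
          rcases Finset.mem_insert.1 hx' with h | h
          · exact hi k h
          · exact hj k (Finset.mem_singleton.1 h)
      rw [Module.finrank_eq_card_basis b] at hr
      omega
    obtain ⟨k₀, hk₀⟩ : ∃ k, b.repr (v j) k ≠ 0 := by
      by_contra! h0
      exact hv j (b.repr.map_eq_zero_iff.1 (Finsupp.ext h0))
    by_cases hfj : f (v j) = 0
    · refine ⟨f + b.coord k₀, fun i => ?_⟩
      by_cases hij : i = j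
      · rw [hij, LinearMap.add_apply, hfj, zero_add]
        exact hk₀
      · obtain ⟨k, rfl⟩ := hrange i hij
        rw [LinearMap.add_apply, hf, ← hb, Module.Basis.coord_apply, Module.Basis.repr_self,
          Finsupp.single_apply]
        split_ifs
        · exact h2
        · exact h1
    · refine ⟨f, fun i => ?_⟩
      by_cases hij : i = j
      · rwa [hij]
      · obtain ⟨k, rfl⟩ := hrange i hij
        rw [hf]
        exact one_ne_zero

variable {n : ℕ} {a : Fin n → ℚˣ}

/-- Condition (b) fails if none of the `a_i` is a cube and `n` is small or the rank is extreme. -/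
theorem not_condB (hn : 1 ≤ n) (hcube : ∀ i, ¬ ∃ b : ℚˣ, a i = b ^ 3)
    (hr : n ≤ 3 ∨ barRank (genGroup a) 3 = 1 ∨ n - 1 ≤ barRank (genGroup a) 3) : ¬ CondB a := by
  have := Fact.mk Nat.prime_three
  let V := Additive (barGroup (genGroup a) 3)
  let : Module (ZMod 3) V := AddCommGroup.zmodModule fun x => barGroup_pow (genGroup a) 3 x.toMul
  let v : Fin n → V := fun i => Additive.ofMul (genClass a 3 i)
  have hv : ∀ i, v i ≠ 0 := by
    intro i h0
    have h1 : genClass a 3 i = 1 := h0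
    obtain ⟨b, hb⟩ := (QuotientGroup.eq_one_iff _).1 (congrArg Subtype.val h1)
    exact hcube i ⟨b, hb.symm⟩
  have hspan : Submodule.span (ZMod 3) (Set.range v) = ⊤ := by
    rw [eq_top_iff]
    intro x _
    obtain ⟨e, he⟩ := expMap_surjective a 3 x.toMul
    have hx : x = ∑ i, (e.toAdd i) • v i := by
      apply Additive.toMul.injective
      rw [← he]
      rfl
    rw [hx]
    exact Submodule.sum_mem _ fun i _ =>
      zsmul_mem (Submodule.subset_span (Set.mem_range_self i)) _
  have hrank : barRank (genGroup a) 3 = Module.finrank (ZMod 3) V := rfl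
  rw [hrank] at hr
  have hfin : Module.Finite (ZMod 3) V :=
    Module.finite_def.2 ⟨(Set.finite_range v).toFinset, by simpa using hspan⟩
  have hpos : 0 < Module.finrank (ZMod 3) V := by
    have : Nontrivial V := ⟨v ⟨0, hn⟩, 0, hv _⟩
    exact Module.finrank_pos
  obtain ⟨f, hf⟩ : ∃ f : V →ₗ[ZMod 3] ZMod 3, ∀ i, f (v i) ≠ 0 := by
    by_cases h1 : n ≤ Module.finrank (ZMod 3) V + 1
    · exact exists_linearForm_ne_zero v hspan hv h1
    · have h2 : Module.finrank (ZMod 3) V = Module.finrank (ZMod 3) (ZMod 3) := by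
        rw [Module.finrank_self]
        omega
      let e := LinearEquiv.ofFinrankEq V (ZMod 3) h2
      exact ⟨e, fun i => by simpa using hv i⟩
  have hexp := Complex.isPrimitiveRoot_exp 3 (by norm_num)
  let ζ : ℂˣ := (hexp.isUnit (by norm_num)).unit
  have hζ : IsPrimitiveRoot ζ 3 := IsPrimitiveRoot.coe_units_iff.1 hexp
  have hle : Subgroup.zpowers ζ ≤ rootsOfUnity 3 ℂ :=
    Subgroup.zpowers_le.2 ((mem_rootsOfUnity 3 ζ).2 hζ.pow_eq_one)
  let χ : barGroup (genGroup a) 3 →* rootsOfUnity 3 ℂ := (Subgroup.inclusion hle).comp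
    (MonoidHom.toAdditive.symm ((hζ.zmodEquivZPowers : ZMod 3 →+ _).comp (f : V →+ ZMod 3)))
  intro hB
  obtain ⟨i, hi⟩ := hB χ
  apply hf i
  have h1 : χ (genClass a 3 i) = 1 := hi
  have h2 : hζ.zmodEquivZPowers (f (v i)) = 0 := by
    apply Additive.toMul.injective
    exact Subgroup.inclusion_injective hle (h1.trans (map_one _).symm)
  simpa using h2

end CubicCharacters

end RadicalDensity

end

theorem theorem6p2 (n : ℕ) (hn : 1 ≤ n) (a : Fin n → ℚˣ)
    (ha : ∀ i, a i ≠ 1 ∧ a i ≠ -1)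
    (h : RadicalDensity.NoOddSquare a) :
    (RadicalDensity.densityInGalois (RadicalDensity.genGroup a) (RadicalDensity.goodSet a) = 0 ↔
      RadicalDensity.CondA a h ∧ RadicalDensity.CondB a) ∧
    ((∀ i, ¬ ∃ b : ℚˣ, a i = b ^ 3) →
      (n ≤ 3 ∨ RadicalDensity.barRank (RadicalDensity.genGroup a) 3 = 1 ∨
        n - 1 ≤ RadicalDensity.barRank (RadicalDensity.genGroup a) 3) →
      ¬ RadicalDensity.CondB a) := by
  refine ⟨⟨fun h0 => ?_, fun hAB => ?_⟩, RadicalDensity.not_condB hn⟩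
  · by_contra hAB
    have hpos := RadicalDensity.haarA_galois_inter_goodSet_pos ha h hAB
    rw [RadicalDensity.densityInGalois, ENNReal.div_eq_zero_iff] at h0
    rcases h0 with h0 | h0
    · exact hpos.ne' h0
    · exact MeasureTheory.measure_ne_top _ _ h0
  · rw [RadicalDensity.densityInGalois,
      RadicalDensity.galoisImage_inter_goodSet_eq_empty h hAB.1 hAB.2, MeasureTheory.measure_empty,
      ENNReal.zero_div]
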